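/- Let $0<q<1$ be real and let $m\ge 0$ be an even integer. Let $v,w$ be variables with $wv=q\,vw$, and let $W$ be the algebra over $\mathbb C$ generated by $v^{\pm1},w^{\pm1}$ and the inverses of all $q^kv-q^{-k}v^{-1}$, $k\in\mathbb Z$; every element of $W$ is uniquely a finite sum $a=\sum_i w^if_i$ with $f_i$ rational functions of $v$. Put $u_+=w(v-v^{-1})^{-1}$, $u_-=w^{-1}(v-v^{-1})^{-1}$ and let $\mathcal A\subset W$ be the subalgebra generated by all $v^k+v^{-k}$ and all $v^ku_++v^{-k}u_-$, $k\in\mathbb Z$. For $a\in\mathbb Z$ put $H_a=q^{a/2}(v^au_++v^{-a}u_-)\in\mathcal A$. There is a unique algebra automorphism $g$ of $\mathcal A$ with $g(H_a)=H_{a+m}$ for all $a\in\mathbb Z$. A $g$-twisted trace is a linear map $T\colon\mathcal A\to\mathbb C$ with $T(ab)=T(b\,g(a))$ for all $a,b\in\mathcal A$. An element $\sum_i w^if_i$ is called even if $f_i=0$ for all odd $i$. Let $$A_0=\mathbb C[v+v^{-1}]+\sum_{k\ne0}\mathbb C\,\frac1{(v-q^k)(v^{-1}-q^k)}+\sum_{k\ne0}\mathbb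 C\,\frac1{(v+q^k)(v^{-1}+q^k)} .$$ Then $f_0\in A_0$ for every $a=\sum_i w^if_i\in\mathcal A$, and every element of $A_0$ is the $f_0$ of some even $a\in\mathcal A$. For every $g$-twisted trace $T$ there is a unique linear map $S\colon A_0\to\mathbb C$ (the even part of $T$) with $T(a)=S(f_0)$ for all even $a=\sum_i w^{i}f_{i}\in\mathcal A$. Let $\Omega$ be the space of holomorphic functions $\omega$ on $\mathbb C^\times$ such that $\omega(z^{-1})=\omega(z)$ and $\omega(qz)=q^{-m/2}z^{-m}\omega(z)$. Then the formula $$S(F)=\int_{\varepsilon S^1}F(z)\,\omega(z)\,\frac{dz}{z},\qquad F\in A_0,$$ where $S^1$ is the unit circle and $\varepsilon>0$ is any number smaller than the absolute values of all poles of $F$ in $\mathbb C^\times$, defines a linear isomorphism $\omega\mapsto S$ from $\Omega$ onto the space of even parts of $g$-twisted traces. In particular the even part of every $g$-twisted trace has this form. Moreover, for every $\omega\in\Omega$ the map $\sum_i w^if_i\mapsto\int_{\varepsilon S^1}f_0(z)\,\omega(z)\,\frac{dz}{z}$ (with $\varepsilon>0$ smaller than the absolute values of all poles of $f_0$ in $\mathbb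 C^\times$) is a $g$-twisted trace on $\mathcal A$. Both $\Omega$ and the space of even parts of $g$-twisted traces have dimension $1+\frac m2$. -/

import Mathlib

noncomputable section

namespace PureSL2

/-! Throughout `q` is a real number with `0 < q < 1`, packaged as an element of `Set.Ioo 0 1`,
and `ℂ(v)` is `RatFunc ℂ`, with `v = RatFunc.X`. -/

/-- `q` as a complex number. -/
def qC (q : Set.Ioo (0 : ℝ) 1) : ℂ := ((q : ℝ) : ℂ)

theorem qC_ne_zero (q : Set.Ioo (0 : ℝ) 1) : qC q ≠ 0 :=
  Complex.ofReal_ne_zero.mpr q.2.1.ne'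

/-- The automorphism `f(v) ↦ f(qv)` of `ℂ(v)`. -/
def qShift (q : Set.Ioo (0 : ℝ) 1) : RatFunc ℂ ≃ₐ[ℂ] RatFunc ℂ :=
  haveI : Invertible (qC q) := invertibleOfNonzero (qC_ne_zero q)
  IsFractionRing.algEquivOfAlgEquiv (Polynomial.algEquivCMulXAddC (qC q) 0)

theorem qShift_X (q : Set.Ioo (0 : ℝ) 1) :
    qShift q RatFunc.X = RatFunc.C (qC q) * RatFunc.X := by
  let _ : Invertible (qC q) := invertibleOfNonzero (qC_ne_zero q)
  have h : qShift q (algebraMap (Polynomial ℂ) (RatFunc ℂ) Polynomial.X) =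
      algebraMap (Polynomial ℂ) (RatFunc ℂ)
        (Polynomial.algEquivCMulXAddC (qC q) 0 Polynomial.X) :=
    IsFractionRing.algEquivOfAlgEquiv_algebraMap _ _
  simpa [RatFunc.algebraMap_X, RatFunc.algebraMap_C] using h

/-- The infinite cyclic group of powers of the generator `w`, written multiplicatively.
The parameter `q` records how it acts on `ℂ(v)`. -/
def PowW (_q : Set.Ioo (0 : ℝ) 1) : Type := Multiplicative ℤ

instance (q : Set.Ioo (0 : ℝ) 1) : CommGroup (PowW q) :=
  inferInstanceAs (CommGroup (Multiplicative ℤ))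

/-- The element `w ^ i` of the group. -/
def powW (q : Set.Ioo (0 : ℝ) 1) (i : ℤ) : PowW q := Multiplicative.ofAdd i

/-- `w ^ i` acts on `ℂ(v)` by `f(v) ↦ f(q ^ i v)`. -/
def actHom (q : Set.Ioo (0 : ℝ) 1) : PowW q →* (RatFunc ℂ ≃ₐ[ℂ] RatFunc ℂ) :=
  zpowersHom (RatFunc ℂ ≃ₐ[ℂ] RatFunc ℂ) (qShift q)

instance (q : Set.Ioo (0 : ℝ) 1) : MulSemiringAction (PowW q) (RatFunc ℂ) :=
  MulSemiringAction.compHom (RatFunc ℂ) (actHom q)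

instance (q : Set.Ioo (0 : ℝ) 1) : SMulCommClass (PowW q) ℂ (RatFunc ℂ) where
  smul_comm g c f := by
    have h : (actHom q g) (c • f) = c • (actHom q g) f := by
      simp only [Algebra.smul_def, map_mul, AlgEquiv.commutes]
    exact h

/-- The skew Laurent polynomial algebra `ℂ(v)[w, w⁻¹]` with `w f(v) = f(qv) w`, so `w v = q v w`.
The localized `q`-Weyl algebra is its subalgebra generated by `v`, `w`, their inverses and the
inverses of all `q ^ k v - q ^ (-k) v⁻¹`. -/
abbrev SkewW (q : Set.Ioo (0 : ℝ) 1) : Type := SkewMonoidAlgebra (RatFunc ℂ) (PowW q)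

/-- A rational function in `v`, as an element of the algebra. -/
def fn (q : Set.Ioo (0 : ℝ) 1) (f : RatFunc ℂ) : SkewW q :=
  SkewMonoidAlgebra.single (powW q 0) f

/-- `w ^ i` as an element of the algebra. -/
def wPow (q : Set.Ioo (0 : ℝ) 1) (i : ℤ) : SkewW q :=
  SkewMonoidAlgebra.single (powW q i) 1

theorem wPow_mul_fn_X (q : Set.Ioo (0 : ℝ) 1) :
    wPow q 1 * fn q RatFunc.X = qC q • (fn q RatFunc.X * wPow q 1) := by
  have h : powW q 1 • (RatFunc.X : RatFunc ℂ) = RatFunc.C (qC q) * RatFunc.X := by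
    have h1 : actHom q (powW q 1) = qShift q := by
      exact zpow_one (qShift q)
    exact (DFunLike.congr_fun h1 RatFunc.X).trans (qShift_X q)
  have h0 : powW q 0 = 1 := rfl
  simp [wPow, fn, SkewMonoidAlgebra.single_mul_single, h, h0, SkewMonoidAlgebra.smul_single,
    RatFunc.smul_eq_C_mul]

/-- `u₊ = w (v - v⁻¹)⁻¹`. -/
def uPlus (q : Set.Ioo (0 : ℝ) 1) : SkewW q :=
  wPow q 1 * fn q (RatFunc.X - RatFunc.X⁻¹)⁻¹

/-- `u₋ = w⁻¹ (v - v⁻¹)⁻¹`. -/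
def uMinus (q : Set.Ioo (0 : ℝ) 1) : SkewW q :=
  wPow q (-1) * fn q (RatFunc.X - RatFunc.X⁻¹)⁻¹

/-- `v ^ k u₊ + v ^ (-k) u₋`. -/
def monopole (q : Set.Ioo (0 : ℝ) 1) (k : ℤ) : SkewW q :=
  fn q (RatFunc.X ^ k) * uPlus q + fn q (RatFunc.X ^ (-k)) * uMinus q

/-- The algebra `𝒜`, generated by all `v ^ k + v ^ (-k)` and all `v ^ k u₊ + v ^ (-k) u₋`. -/
def algA (q : Set.Ioo (0 : ℝ) 1) : Subalgebra ℂ (SkewW q) :=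
  Algebra.adjoin ℂ
    (Set.range (fun k : ℤ => fn q (RatFunc.X ^ k + RatFunc.X ^ (-k))) ∪
      Set.range (fun k : ℤ => monopole q k))

/-- `H_a = q ^ (a / 2) (v ^ a u₊ + v ^ (-a) u₋)`, as an element of `𝒜`. -/
def H (q : Set.Ioo (0 : ℝ) 1) (a : ℤ) : algA q :=
  (((q : ℝ) ^ ((a : ℝ) / 2) : ℝ) : ℂ) •
    ⟨monopole q a, Algebra.subset_adjoin (Or.inr ⟨a, rfl⟩)⟩

/-- The coefficient at `w ^ i`. It is the coefficient with `w ^ i` written on the right;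
writing `w ^ i` on the left instead replaces `f(v)` by `f(q ^ (-i) v)`, which changes neither the
coefficient at `w ^ 0` nor which coefficients vanish. -/
def wCoeff {q : Set.Ioo (0 : ℝ) 1} (i : ℤ) (a : algA q) : RatFunc ℂ :=
  (a : SkewW q).coeff (powW q i)

/-- `a` is even: only even powers of `w` occur in it. -/
def IsEvenElt {q : Set.Ioo (0 : ℝ) 1} (a : algA q) : Prop :=
  ∀ i : ℤ, Odd i → wCoeff i a = 0

/-- The space `A₀` spanned by `ℂ[v + v⁻¹]` and by the functions `1 / ((v - q^k)(v⁻¹ - q^k))` and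
`1 / ((v + q^k)(v⁻¹ + q^k))` for nonzero integers `k`. -/
def A0 (q : Set.Ioo (0 : ℝ) 1) : Submodule ℂ (RatFunc ℂ) :=
  Subalgebra.toSubmodule (Algebra.adjoin ℂ {RatFunc.X + RatFunc.X⁻¹}) ⊔
  Submodule.span ℂ {F | ∃ k : ℤ, k ≠ 0 ∧
    F = ((RatFunc.X - RatFunc.C (qC q ^ k)) * (RatFunc.X⁻¹ - RatFunc.C (qC q ^ k)))⁻¹} ⊔
  Submodule.span ℂ {F | ∃ k : ℤ, k ≠ 0 ∧
    F = ((RatFunc.X + RatFunc.C (qC q ^ k)) * (RatFunc.X⁻¹ + RatFunc.C (qC q ^ k)))⁻¹}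

/-- `T` is a `g`-twisted trace: `T(ab) = T(b g(a))`. -/
def IsTwistedTrace {q : Set.Ioo (0 : ℝ) 1} (g : algA q ≃ₐ[ℂ] algA q)
    (T : algA q →ₗ[ℂ] ℂ) : Prop :=
  ∀ a b : algA q, T (a * b) = T (b * g a)

/-- `S` computes `T` on even elements: `T(∑ w^{2i} f_{2i}) = S(f₀)`. -/
def IsEvenPart {q : Set.Ioo (0 : ℝ) 1} (T : algA q →ₗ[ℂ] ℂ) (S : A0 q →ₗ[ℂ] ℂ) : Prop :=
  ∀ a : algA q, IsEvenElt a → ∀ F : A0 q, (F : RatFunc ℂ) = wCoeff 0 a → T a = S F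

/-- The space of functionals on `A₀` that are even parts of `g`-twisted traces. -/
def evenTraces {q : Set.Ioo (0 : ℝ) 1} (g : algA q ≃ₐ[ℂ] algA q) :
    Submodule ℂ (A0 q →ₗ[ℂ] ℂ) where
  carrier := {S | ∃ T : algA q →ₗ[ℂ] ℂ, IsTwistedTrace g T ∧ IsEvenPart T S}
  zero_mem' := ⟨0, fun _ _ => rfl, fun _ _ _ _ => rfl⟩
  add_mem' := by
    rintro S S' ⟨T, hT, hS⟩ ⟨T', hT', hS'⟩
    refine ⟨T + T', fun a b => ?_, fun a ha F hF => ?_⟩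
    · simp [hT a b, hT' a b]
    · simp [hS a ha F hF, hS' a ha F hF]
  smul_mem' := by
    rintro c S ⟨T, hT, hS⟩
    refine ⟨c • T, fun a b => ?_, fun a ha F hF => ?_⟩
    · simp [hT a b]
    · simp [hS a ha F hF]

/-- The space of holomorphic functions `ω` on `ℂ \ {0}` with `ω(z⁻¹) = ω(z)` and
`ω(qz) = q ^ (-m/2) z ^ (-m) ω(z)`. Functions on `ℂ \ {0}` are represented by functions on `ℂ`
that take the value `0` at `0`. -/
def quasiPeriodic (q : Set.Ioo (0 : ℝ) 1) (m : ℕ) : Submodule ℂ (ℂ → ℂ) where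
  carrier := {ω | DifferentiableOn ℂ ω {0}ᶜ ∧ ω 0 = 0 ∧ (∀ z : ℂ, z ≠ 0 → ω z⁻¹ = ω z) ∧
    ∀ z : ℂ, z ≠ 0 →
      ω (qC q * z) = (((q : ℝ) ^ (-(m : ℝ) / 2) : ℝ) : ℂ) * z ^ (-(m : ℤ)) * ω z}
  zero_mem' := ⟨differentiableOn_const 0, rfl, fun _ _ => rfl, fun _ _ => by simp⟩
  add_mem' := by
    rintro ω ω' ⟨h1, h2, h3, h4⟩ ⟨h1', h2', h3', h4'⟩
    refine ⟨h1.add h1', by simp [h2, h2'], fun z hz => ?_, fun z hz => ?_⟩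
    · simp [h3 z hz, h3' z hz]
    · simp only [Pi.add_apply, h4 z hz, h4' z hz]; ring
  smul_mem' := by
    rintro c ω ⟨h1, h2, h3, h4⟩
    refine ⟨h1.const_smul c, by simp [h2], fun z hz => ?_, fun z hz => ?_⟩
    · simp [h3 z hz]
    · simp only [Pi.smul_apply, smul_eq_mul, h4 z hz]; ring

/-- `ε` is positive and smaller than the absolute values of all nonzero poles of `F`. -/
def IsSmallRadius (F : RatFunc ℂ) (ε : ℝ) : Prop :=
  0 < ε ∧ ∀ p : ℂ, p ≠ 0 → F.denom.IsRoot p → ε < ‖p‖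

end PureSL2

end

noncomputable section

namespace PureSL2

variable (q : Set.Ioo (0 : ℝ) 1)

/-! ### The skew Laurent polynomial algebra -/

/-! Write `m = 2μ`, `E_k = v^k u₊ + v^(-k) u₋` (`monA`) and `s_k = v^k + v^(-k)` (`symA`). The
automorphism `g` is the restriction of `v ↦ v`, `w ↦ q^μ v^(2μ) w`; it is unique because the `E_k`
alone generate `𝒜` (`algHom_ext_monA`).

Upper bound: the even part of a twisted trace `T` is determined by `T(s_0), ..., T(s_μ)`
(`trace_eq_zero_of_isEvenElt`). Since `g` fixes `v + v⁻¹`, `T` kills commutators with it. Combined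
with the twist this gives `T(s_{k+2μ}) = q^(k+μ) T(s_k)`, and `s_{-k} = s_k` then leaves only `0 ≤ k
≤ μ`. For longer words, `E_a E_b` equals `q^b E_{a+b} E_0` up to words with two letters fewer
(`trace_swap`), so a trace vanishing on words of length `n` has one unknown sequence on words of
length `n + 2`, and the trace conditions force it to be zero (`trace_words_succ`).

Lower bound: each `ω` gives a twisted trace, because `z ↦ q^i z` carries a small circle around zero
to another one, crossing no pole in between, and quasi-periodicity absorbs the twist
(`skewTrace_mul`). Theta series realise arbitrary values on `s_0, ..., s_μ`
(`exists_quasiPeriodic`). If these values vanish, the upper bound applied to the trace of `ω` kills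
every Laurent coefficient of `ω` (`eq_zero_of_pairing_symR`). So `Ω` and the space of even parts are
both identified with `ℂ^(μ+1)`.

Constant coefficients: operators built from multiplication by `v + v⁻¹` on both sides remove the
coefficients at `w^(±2l)` one pair at a time (`coeff_zero_mul_prod_mem`); what remains is a function
of `v` in `𝒜`, which a representation on antisymmetric Laurent polynomials shows to be a symmetric
Laurent polynomial. Partial fractions then give membership in `A₀`. Conversely, the poles come from
`E_0²` multiplied on both sides by powers of `w` (`poleR_mem`). -/

/-- The monomial `f w ^ i`. -/
def mono (i : ℤ) (f : RatFunc ℂ) : SkewW q := SkewMonoidAlgebra.single (powW q i) f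

/-- The automorphism `f(v) ↦ f(q ^ i v)`. -/
def shift (i : ℤ) : RatFunc ℂ ≃ₐ[ℂ] RatFunc ℂ := qShift q ^ i

/-- The scalar `q` as a rational function. -/
def qR : RatFunc ℂ := RatFunc.C (qC q)

theorem qR_ne_zero : qR q ≠ 0 := by
  simpa [qR] using qC_ne_zero q

theorem shift_zero (f : RatFunc ℂ) : shift q 0 f = f := rfl

theorem shift_shift (i j : ℤ) (f : RatFunc ℂ) : shift q i (shift q j f) = shift q (i + j) f := by
  simp [shift, zpow_add]

theorem shift_C (i : ℤ) (c : ℂ) : shift q i (RatFunc.C c) = RatFunc.C c := by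
  simpa [RatFunc.algebraMap_eq_C] using (shift q i).commutes c

theorem shift_qR (i : ℤ) : shift q i (qR q) = qR q := shift_C q i _

theorem shift_X (i : ℤ) : shift q i RatFunc.X = qR q ^ i * RatFunc.X := by
  have h1 : shift q 1 RatFunc.X = qR q * RatFunc.X := by
    rw [shift, zpow_one, qShift_X, qR]
  have hneg : shift q (-1) RatFunc.X = (qR q)⁻¹ * RatFunc.X := by
    apply (shift q 1).injective
    rw [shift_shift, map_mul, map_inv₀, shift_qR, h1]
    simp [shift_zero, qR_ne_zero]
  induction i with
  | zero => simp [shift_zero]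
  | succ n ih =>
    rw [← shift_shift, h1, map_mul, ih, shift_qR, zpow_add₀ (qR_ne_zero q)]; simp; ring
  | pred n ih =>
    rw [sub_eq_add_neg, ← shift_shift, hneg, map_mul, map_inv₀, ih, shift_qR,
      zpow_add₀ (qR_ne_zero q)]; simp; ring

theorem mono_mul (i j : ℤ) (f g : RatFunc ℂ) :
    mono q i f * mono q j g = mono q (i + j) (f * shift q i g) := by
  rw [mono, mono, SkewMonoidAlgebra.single_mul_single]; rfl

theorem mono_add (i : ℤ) (f g : RatFunc ℂ) : mono q i (f + g) = mono q i f + mono q i g :=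
  SkewMonoidAlgebra.single_add _ _ _

theorem mono_sub (i : ℤ) (f g : RatFunc ℂ) : mono q i (f - g) = mono q i f - mono q i g := by
  rw [eq_sub_iff_add_eq, ← mono_add, sub_add_cancel]

theorem mono_neg (i : ℤ) (f : RatFunc ℂ) : mono q i (-f) = -mono q i f :=
  SkewMonoidAlgebra.single_neg _ _

theorem mono_zero (i : ℤ) : mono q i 0 = 0 := SkewMonoidAlgebra.single_zero _

theorem mono_smul (i : ℤ) (c : ℂ) (f : RatFunc ℂ) : c • mono q i f = mono q i (RatFunc.C c * f) := by
  rw [mono, mono, SkewMonoidAlgebra.smul_single, RatFunc.smul_eq_C_mul]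

theorem one_eq_mono : (1 : SkewW q) = mono q 0 1 := rfl

theorem fn_eq_mono (f : RatFunc ℂ) : fn q f = mono q 0 f := rfl

theorem coeff_mono (i j : ℤ) (f : RatFunc ℂ) :
    (mono q i f).coeff (powW q j) = if i = j then f else 0 := by
  classical
  have h : powW q i = powW q j ↔ i = j := Multiplicative.ofAdd.injective.eq_iff
  rw [mono, SkewMonoidAlgebra.coeff_single, Finsupp.single_apply]
  simp only [h]

theorem skew_ext {a b : SkewW q} (h : ∀ i, a.coeff (powW q i) = b.coeff (powW q i)) : a = b :=
  SkewMonoidAlgebra.ext fun g => h g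

theorem skew_induction {p : SkewW q → Prop} (a : SkewW q) (h0 : p 0)
    (hadd : ∀ a b, p a → p b → p (a + b)) (hm : ∀ i f, p (mono q i f)) : p a :=
  SkewMonoidAlgebra.induction_on a h0 (fun g f => hm g f) (fun a b => hadd a b)

theorem coeff_mono_mul (i j : ℤ) (f : RatFunc ℂ) (a : SkewW q) :
    (mono q i f * a).coeff (powW q j) = f * shift q i (a.coeff (powW q (j - i))) := by
  induction a using skew_induction q with
  | h0 => simp
  | hadd a b ha hb => simp [mul_add, ha, hb]
  | hm k g =>
    rw [mono_mul, coeff_mono, coeff_mono]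
    by_cases h : i + k = j
    · rw [if_pos h, if_pos (by omega)]
    · rw [if_neg h, if_neg (by omega)]; simp

theorem coeff_mul_mono (i j : ℤ) (f : RatFunc ℂ) (a : SkewW q) :
    (a * mono q i f).coeff (powW q j) = a.coeff (powW q (j - i)) * shift q (j - i) f := by
  induction a using skew_induction q with
  | h0 => simp
  | hadd a b ha hb => simp [add_mul, ha, hb]
  | hm k g =>
    rw [mono_mul, coeff_mono, coeff_mono]
    by_cases h : k + i = j
    · rw [if_pos h, if_pos (by omega), show k = j - i by omega]
    · rw [if_neg h, if_neg (by omega)]; simp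

/-- `q ^ j v - q ^ (-j) v⁻¹`. -/
def D (j : ℤ) : RatFunc ℂ := qR q ^ j * RatFunc.X - qR q ^ (-j) * RatFunc.X⁻¹

theorem X_sq_ne_C (c : ℂ) : (RatFunc.X : RatFunc ℂ) ^ 2 ≠ RatFunc.C c := by
  intro h
  have h2 : algebraMap (Polynomial ℂ) (RatFunc ℂ) (Polynomial.X ^ 2) =
      algebraMap (Polynomial ℂ) (RatFunc ℂ) (Polynomial.C c) := by
    simpa [RatFunc.algebraMap_X, RatFunc.algebraMap_C] using h
  have h3 := congrArg Polynomial.natDegree (IsFractionRing.injective _ (RatFunc ℂ) h2)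
  simp at h3

theorem D_ne_zero (j : ℤ) : D q j ≠ 0 := by
  intro h
  apply X_sq_ne_C (qC q ^ (-2 * j))
  have hX : (RatFunc.X : RatFunc ℂ) ≠ 0 := RatFunc.X_ne_zero
  have hq := zpow_ne_zero j (qR_ne_zero q)
  rw [D, sub_eq_zero, zpow_neg] at h
  rw [map_zpow₀, ← qR, show -2 * j = -j + -j by ring, zpow_add₀ (qR_ne_zero q), zpow_neg]
  field_simp at h ⊢
  linear_combination h

theorem shift_D (i j : ℤ) : shift q i (D q j) = D q (j + i) := by
  simp only [D, map_sub, map_mul, map_zpow₀, map_inv₀, shift_qR, shift_X, neg_add,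
    zpow_add₀ (qR_ne_zero q)]
  simp only [zpow_neg, mul_inv]
  ring

theorem D_zero : D q 0 = RatFunc.X - RatFunc.X⁻¹ := by simp [D]

theorem uPlus_eq : uPlus q = mono q 1 (D q 1)⁻¹ := by
  rw [uPlus, wPow, ← mono, fn_eq_mono, mono_mul, ← D_zero, map_inv₀, shift_D]
  simp

theorem uMinus_eq : uMinus q = mono q (-1) (D q (-1))⁻¹ := by
  rw [uMinus, wPow, ← mono, fn_eq_mono, mono_mul, ← D_zero, map_inv₀, shift_D]
  simp

theorem monopole_eq (k : ℤ) : monopole q k =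
    mono q 1 (RatFunc.X ^ k * (D q 1)⁻¹) + mono q (-1) (RatFunc.X ^ (-k) * (D q (-1))⁻¹) := by
  simp [monopole, uPlus_eq, uMinus_eq, fn_eq_mono, mono_mul, shift_zero]

instance : IsScalarTower ℂ (SkewW q) (SkewW q) := IsScalarTower.right (R := ℂ) (A := SkewW q)

instance : SMulCommClass ℂ (SkewW q) (SkewW q) :=
  Algebra.to_smulCommClass (R := ℂ) (A := SkewW q)

/-! ### Group structure on `𝒜`

These instances have `Subalgebra.toSemiring` as a reducible parent. -/

instance (priority := high) instAddCommGroupAlgA : AddCommGroup (algA q) :=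
  { (Subalgebra.toRing (algA q)).toAddCommGroup with
    toAddCommMonoid := (Subalgebra.toSemiring (algA q)).toAddCommMonoid }

instance (priority := high) instRingAlgA : Ring (algA q) :=
  { Subalgebra.toRing (algA q) with toSemiring := Subalgebra.toSemiring (algA q) }

instance (priority := high) instSubAlgA : Sub (algA q) := (instRingAlgA q).toSub

/-! ### The generators as elements of `𝒜` -/

/-- `v ^ k + v ^ (-k)` as a rational function. -/
def symR (k : ℤ) : RatFunc ℂ := RatFunc.X ^ k + RatFunc.X ^ (-k)

/-- `v ^ k + v ^ (-k)` in `𝒜`. -/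
def symA (k : ℤ) : algA q :=
  ⟨fn q (RatFunc.X ^ k + RatFunc.X ^ (-k)), Algebra.subset_adjoin (Or.inl ⟨k, rfl⟩)⟩

/-- `v ^ k u₊ + v ^ (-k) u₋` in `𝒜`. -/
def monA (k : ℤ) : algA q := ⟨monopole q k, Algebra.subset_adjoin (Or.inr ⟨k, rfl⟩)⟩

theorem coe_symA (k : ℤ) : (symA q k : SkewW q) = mono q 0 (symR k) := rfl

theorem coe_monA (k : ℤ) : (monA q k : SkewW q) =
    mono q 1 (RatFunc.X ^ k * (D q 1)⁻¹) + mono q (-1) (RatFunc.X ^ (-k) * (D q (-1))⁻¹) :=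
  monopole_eq q k

theorem algA_induction {p : algA q → Prop} (a : algA q) (hs : ∀ k, p (symA q k))
    (hm : ∀ k, p (monA q k)) (hc : ∀ c : ℂ, p (algebraMap ℂ _ c))
    (hadd : ∀ a b, p a → p b → p (a + b)) (hmul : ∀ a b, p a → p b → p (a * b)) : p a := by
  obtain ⟨a, ha⟩ := a
  refine Algebra.adjoin_induction (p := fun x hx => p ⟨x, hx⟩) ?_ hc
    (fun x y hx hy => hadd ⟨x, hx⟩ ⟨y, hy⟩) (fun x y hx hy => hmul ⟨x, hx⟩ ⟨y, hy⟩) ha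
  rintro x (⟨k, rfl⟩ | ⟨k, rfl⟩)
  exacts [hs k, hm k]

theorem shift_X_zpow (i k : ℤ) :
    shift q i (RatFunc.X ^ k) = qR q ^ (i * k) * RatFunc.X ^ k := by
  rw [map_zpow₀, shift_X, mul_zpow, ← zpow_mul]

theorem C_zpow (i : ℤ) : RatFunc.C (qC q ^ i) = qR q ^ i := map_zpow₀ _ _ _

theorem symA_mul_monA (j k : ℤ) : symA q j * monA q k = monA q (k + j) + monA q (k - j) := by
  apply Subtype.ext
  have hX : (RatFunc.X : RatFunc ℂ) ≠ 0 := RatFunc.X_ne_zero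
  simp only [MulMemClass.coe_mul, AddMemClass.coe_add, coe_symA, coe_monA, mul_add, mono_mul,
    shift_zero, zero_add, symR]
  rw [add_add_add_comm, ← mono_add, ← mono_add]
  simp only [neg_add, sub_eq_add_neg, zpow_add₀ hX, neg_neg]
  congr 2 <;> ring

theorem monA_mul_symA (j k : ℤ) : monA q k * symA q j =
    qC q ^ j • monA q (k + j) + qC q ^ (-j) • monA q (k - j) := by
  apply Subtype.ext
  have hX : (RatFunc.X : RatFunc ℂ) ≠ 0 := RatFunc.X_ne_zero
  simp only [MulMemClass.coe_mul, AddMemClass.coe_add, SetLike.val_smul, coe_symA, coe_monA,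
    add_mul, mono_mul, add_zero, symR, smul_add, mono_smul, C_zpow, map_add, shift_X_zpow]
  rw [add_add_add_comm, ← mono_add, ← mono_add]
  simp only [neg_add, sub_eq_add_neg, zpow_add₀ hX, neg_neg, one_mul, neg_mul]
  congr 2 <;> ring

/-- After division by `q^b` the coefficients at `w^(±2)` depend only on `a + b`; this is what makes
`monA_swap` possible. -/
theorem monA_mul_monA (a b : ℤ) : (monA q a * monA q b : SkewW q) =
    mono q 2 (qR q ^ b * RatFunc.X ^ (a + b) * ((D q 1)⁻¹ * (D q 2)⁻¹)) +
    mono q 0 (qR q ^ (-b) * (RatFunc.X ^ (a - b) * ((D q 1)⁻¹ * (D q 0)⁻¹) +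
      RatFunc.X ^ (b - a) * ((D q (-1))⁻¹ * (D q 0)⁻¹))) +
    mono q (-2) (qR q ^ b * RatFunc.X ^ (-a - b) * ((D q (-1))⁻¹ * (D q (-2))⁻¹)) := by
  have hX : (RatFunc.X : RatFunc ℂ) ≠ 0 := RatFunc.X_ne_zero
  simp only [coe_monA, add_mul, mul_add, mono_mul, map_mul, map_inv₀, shift_D, shift_X_zpow]
  norm_num only
  rw [show ∀ A B C E : SkewW q, A + B + (C + E) = A + (C + B) + E by intros; abel, ← mono_add]
  simp only [sub_eq_add_neg, zpow_add₀ hX, one_mul, neg_mul, neg_neg, mul_neg]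
  congr 2
  · congr 1; ring
  · congr 1; ring
  · ring

/-! ### Symmetric Laurent polynomials -/

/-- The span of all `v ^ k + v ^ (-k)`. -/
def symSpan : Submodule ℂ (RatFunc ℂ) := Submodule.span ℂ (Set.range symR)

/-- The span of all `v ^ k + v ^ (-k)` in `𝒜`. -/
def symSpanA : Submodule ℂ (algA q) := Submodule.span ℂ (Set.range (symA q))

theorem symR_mem (k : ℤ) : symR k ∈ symSpan := Submodule.subset_span ⟨k, rfl⟩

theorem symR_mul (j k : ℤ) : symR j * symR k = symR (j + k) + symR (j - k) := by
  have hX : (RatFunc.X : RatFunc ℂ) ≠ 0 := RatFunc.X_ne_zero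
  simp only [symR, sub_eq_add_neg, neg_add, neg_neg, zpow_add₀ hX]
  ring

theorem symR_neg (k : ℤ) : symR (-k) = symR k := by simp [symR, add_comm]

theorem symSpan_mul {f g : RatFunc ℂ} (hf : f ∈ symSpan) (hg : g ∈ symSpan) : f * g ∈ symSpan := by
  have h : symSpan * symSpan ≤ symSpan := by
    rw [symSpan, Submodule.span_mul_span, Submodule.span_le]
    rintro _ ⟨_, ⟨j, rfl⟩, _, ⟨k, rfl⟩, rfl⟩
    change symR j * symR k ∈ symSpan
    rw [symR_mul]
    exact add_mem (symR_mem _) (symR_mem _)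
  exact h (Submodule.mul_mem_mul hf hg)

theorem one_mem_symSpan : (1 : RatFunc ℂ) ∈ symSpan := by
  have h := symSpan.smul_mem (1 / 2 : ℂ) (symR_mem 0)
  convert h using 1
  rw [symR, RatFunc.smul_eq_C_mul, show (RatFunc.X : RatFunc ℂ) ^ (0 : ℤ) + RatFunc.X ^ (-0 : ℤ) =
    RatFunc.C 1 + RatFunc.C 1 by norm_num, ← map_add, ← map_mul]
  norm_num

theorem C_mem_symSpan (c : ℂ) : RatFunc.C c ∈ symSpan := by
  have h := symSpan.smul_mem c one_mem_symSpan
  rwa [RatFunc.smul_eq_C_mul, mul_one] at h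

theorem symR_mem_adjoin (k : ℤ) :
    symR k ∈ Algebra.adjoin ℂ {(RatFunc.X : RatFunc ℂ) + RatFunc.X⁻¹} := by
  set x : RatFunc ℂ := RatFunc.X + RatFunc.X⁻¹ with hx
  have h1 : symR 1 = x := by simp [symR, hx]
  have hxm : x ∈ Algebra.adjoin ℂ {x} := Algebra.subset_adjoin rfl
  have h0 : symR 0 ∈ Algebra.adjoin ℂ {x} := by
    simpa [symR] using add_mem (one_mem (Algebra.adjoin ℂ {x})) (one_mem _)
  have key : ∀ n : ℕ, symR n ∈ Algebra.adjoin ℂ {x} ∧ symR (n + 1) ∈ Algebra.adjoin ℂ {x} := by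
    intro n
    induction n with
    | zero => exact ⟨h0, by simp [h1]⟩
    | succ n ih =>
      refine ⟨by simpa using ih.2, ?_⟩
      have h := symR_mul (n + 1) 1
      rw [add_sub_cancel_right] at h
      rw [Nat.cast_succ, ← sub_eq_of_eq_add h, h1]
      exact sub_mem (mul_mem ih.2 hxm) ih.1
  obtain ⟨n, rfl | rfl⟩ := k.eq_nat_or_neg
  · exact (key n).1
  · rw [symR_neg]; exact (key n).1

theorem symSpan_eq : symSpan =
    Subalgebra.toSubmodule (Algebra.adjoin ℂ {(RatFunc.X : RatFunc ℂ) + RatFunc.X⁻¹}) := by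
  apply le_antisymm
  · rw [symSpan, Submodule.span_le]
    rintro _ ⟨k, rfl⟩
    exact symR_mem_adjoin k
  · intro f hf
    rw [Subalgebra.mem_toSubmodule] at hf
    induction hf using Algebra.adjoin_induction with
    | mem x hx =>
      rw [Set.mem_singleton_iff] at hx
      rw [hx, show (RatFunc.X : RatFunc ℂ) + RatFunc.X⁻¹ = symR 1 by simp [symR]]
      exact symR_mem 1
    | algebraMap r => exact C_mem_symSpan r
    | add x y hx hy h1 h2 => exact add_mem h1 h2
    | mul x y hx hy h1 h2 => exact symSpan_mul h1 h2

theorem mem_algA_of_mem_symSpan {f : RatFunc ℂ} (hf : f ∈ symSpan) :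
    ∃ a ∈ symSpanA q, (a : SkewW q) = mono q 0 f := by
  induction hf using Submodule.span_induction with
  | mem x hx =>
    obtain ⟨k, rfl⟩ := hx
    exact ⟨symA q k, Submodule.subset_span ⟨k, rfl⟩, rfl⟩
  | zero => exact ⟨0, zero_mem _, by simp [mono_zero]⟩
  | add x y hx hy h1 h2 =>
    obtain ⟨a, ha, ha'⟩ := h1
    obtain ⟨b, hb, hb'⟩ := h2
    exact ⟨a + b, add_mem ha hb, by simp [ha', hb', mono_add]⟩
  | smul c x hx h =>
    obtain ⟨a, ha, ha'⟩ := h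
    exact ⟨c • a, Submodule.smul_mem _ _ ha, by simp [ha', mono_smul, RatFunc.smul_eq_C_mul]⟩

/-- `(v ^ n - v ^ (-n)) / (v - v⁻¹)`. -/
def chiR (n : ℤ) : RatFunc ℂ := (RatFunc.X ^ n - RatFunc.X ^ (-n)) * (D q 0)⁻¹

/-- These are Chebyshev polynomials of the second kind in `v + v⁻¹`, with `χ_{n+1} = s_n + χ_{n-1}`.
-/
theorem chiR_mem (n : ℤ) : chiR q n ∈ symSpan := by
  have hX : (RatFunc.X : RatFunc ℂ) ≠ 0 := RatFunc.X_ne_zero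
  have hD := D_ne_zero q 0
  have hrec : ∀ n : ℤ, chiR q (n + 1) = symR n + chiR q (n - 1) := by
    intro n
    simp only [chiR, symR]
    field_simp
    rw [D_zero]
    simp only [sub_eq_add_neg, neg_add, neg_neg, zpow_add₀ hX, zpow_one, zpow_neg]
    field_simp
    ring
  have h0 : chiR q 0 = 0 := by simp [chiR]
  have key : ∀ n : ℕ, chiR q n ∈ symSpan ∧ chiR q (n + 1) ∈ symSpan := by
    intro n
    induction n with
    | zero =>
      refine ⟨by simp [h0], ?_⟩
      rw [Nat.cast_zero, zero_add, chiR, zpow_neg, zpow_one, ← D_zero q, mul_inv_cancel₀ hD]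
      exact one_mem_symSpan
    | succ n ih =>
      refine ⟨by simpa using ih.2, ?_⟩
      rw [hrec, Nat.cast_succ, add_sub_cancel_right]
      exact add_mem (symR_mem _) ih.1
  obtain ⟨n, rfl | rfl⟩ := n.eq_nat_or_neg
  · exact (key n).1
  · have : chiR q (-n) = - chiR q n := by simp only [chiR, neg_neg]; ring
    rw [this]
    exact neg_mem (key n).1

/-! ### Relations between the generators -/

/-- The coefficients at `w^(±2)` cancel, and in the constant term the denominators `D 1` and `D
(-1)` cancel too. Hence moving one unit of index between neighbouring letters costs only a symmetric
Laurent polynomial. -/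
theorem monA_swap (a b : ℤ) : ((qC q ^ (-b) • (monA q a * monA q b) -
    qC q ^ (-b - 1) • (monA q (a - 1) * monA q (b + 1)) : algA q) : SkewW q) =
    mono q 0 (qR q ^ (-b - b - 1) * chiR q (a - b - 1)) := by
  have hX : (RatFunc.X : RatFunc ℂ) ≠ 0 := RatFunc.X_ne_zero
  have hQ := qR_ne_zero q
  have h0 := D_ne_zero q 0
  have h1 := D_ne_zero q 1
  have h2 := D_ne_zero q (-1)
  simp only [AddSubgroupClass.coe_sub, SetLike.val_smul, MulMemClass.coe_mul, monA_mul_monA,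
    smul_add, mono_smul, C_zpow]
  rw [show ∀ A B C E F G : SkewW q, A + B + C - (E + F + G) = (A - E) + (B - F) + (C - G) by
    intros; abel, ← mono_sub, ← mono_sub, ← mono_sub]
  convert_to _ = mono q 2 0 + mono q 0 _ + mono q (-2) 0 using 1
  · rw [mono_zero, mono_zero, zero_add, add_zero]
  congr 2
  · congr 1
    simp only [sub_eq_add_neg, zpow_add₀ hX, zpow_add₀ hQ, zpow_one, zpow_neg]
    field_simp
    ring
  · congr 1
    rw [chiR]
    field_simp
    simp only [D, sub_eq_add_neg, neg_add, neg_neg, zpow_add₀ hX, zpow_add₀ hQ, zpow_one, zpow_neg]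
    field_simp
    ring
  · simp only [sub_eq_add_neg, neg_add, neg_neg, zpow_add₀ hX, zpow_add₀ hQ, zpow_one, zpow_neg]
    field_simp
    ring

/-- Telescoping three swaps leaves the terms `χ_2`, `χ_0 = 0` and `χ_{-2}`, with `χ_2 = v + v⁻¹`.
Index distance 3 is the smallest that produces a non-scalar, and so it recovers `v + v⁻¹` from the
`E_k`. -/
theorem monA_commutator (b : ℤ) : qC q ^ (-b) • (monA q (b + 3) * monA q b) -
    qC q ^ (-b - 3) • (monA q b * monA q (b + 3)) =
    (qC q ^ (-b - b - 3) * (qC q ^ 2 - (qC q ^ 2)⁻¹)) • symA q 1 := by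
  apply Subtype.ext
  have hX : (RatFunc.X : RatFunc ℂ) ≠ 0 := RatFunc.X_ne_zero
  have hQ := qR_ne_zero q
  have h0 := D_ne_zero q 0
  have h1 := D_ne_zero q 1
  have h2 := D_ne_zero q (-1)
  simp only [AddSubgroupClass.coe_sub, SetLike.val_smul, MulMemClass.coe_mul, monA_mul_monA,
    smul_add, mono_smul, C_zpow, coe_symA, map_mul, map_sub, map_inv₀, map_pow]
  rw [show ∀ A B C E F G : SkewW q, A + B + C - (E + F + G) = (A - E) + (B - F) + (C - G) by
    intros; abel, ← mono_sub, ← mono_sub, ← mono_sub]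
  convert_to _ = mono q 2 0 + mono q 0 _ + mono q (-2) 0 using 1
  · rw [mono_zero, mono_zero, zero_add, add_zero]
  have e3 : ∀ y : RatFunc ℂ, y ^ (3 : ℤ) = y * y * y := fun y => by
    rw [show (3 : ℤ) = (3 : ℕ) by rfl, zpow_natCast]; ring
  change mono q 2 _ + _ + _ = _
  rw [← qR]
  congr 2
  · congr 1
    simp only [sub_eq_add_neg, zpow_add₀ hX, zpow_add₀ hQ, e3, zpow_neg]
    field_simp
    ring
  · congr 1
    rw [symR]
    field_simp
    simp only [D, sub_eq_add_neg, neg_add, neg_neg, zpow_add₀ hX, zpow_add₀ hQ, zpow_one, zpow_neg, e3]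
    field_simp
    ring
  · simp only [sub_eq_add_neg, neg_add, zpow_add₀ hX, zpow_add₀ hQ, e3, zpow_neg]
    field_simp
    ring

theorem C_qC : RatFunc.C (qC q) = qR q := rfl

/-- `v ^ a w - v ^ (-a) w⁻¹` in `𝒜`. -/
def nA (a : ℤ) : algA q := qC q • monA q (a + 1) - (qC q)⁻¹ • monA q (a - 1)

/-- The numerators combine to `v^a D 1` and `-v^(-a) D (-1)`, cancelling both denominators; this is
the source of the minus sign. -/
theorem coe_nA (a : ℤ) : (nA q a : SkewW q) =
    mono q 1 (RatFunc.X ^ a) - mono q (-1) (RatFunc.X ^ (-a)) := by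
  have hX : (RatFunc.X : RatFunc ℂ) ≠ 0 := RatFunc.X_ne_zero
  have hQ := qR_ne_zero q
  have h1 := D_ne_zero q 1
  have h2 := D_ne_zero q (-1)
  simp only [nA, AddSubgroupClass.coe_sub, SetLike.val_smul, coe_monA, smul_add, mono_smul,
    map_inv₀, C_qC]
  rw [add_sub_add_comm, ← mono_sub, ← mono_sub, sub_eq_add_neg (mono q 1 _), ← mono_neg]
  congr 2
  · field_simp
    simp only [D, sub_eq_add_neg, zpow_add₀ hX, zpow_one, zpow_neg]
    field_simp
  · field_simp
    simp only [D, sub_eq_add_neg, neg_add, neg_neg, zpow_add₀ hX, zpow_one, zpow_neg]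
    field_simp
    ring

/-- `w ^ j + (-1) ^ j w ^ (-j)` lies in `𝒜`. -/
theorem exists_powW_sym (j : ℕ) : ∃ a : algA q,
    (a : SkewW q) = mono q j 1 + (-1 : ℂ) ^ j • mono q (-j) 1 := by
  have key : ∀ j : ℕ, (∃ a : algA q, (a : SkewW q) = mono q j 1 + (-1 : ℂ) ^ j • mono q (-j) 1) ∧
      ∃ a : algA q, (a : SkewW q) =
        mono q (j + 1) 1 + (-1 : ℂ) ^ (j + 1) • mono q (-(j + 1)) 1 := by
    intro j
    induction j with
    | zero =>
      refine ⟨⟨2, ?_⟩, ⟨nA q 0, ?_⟩⟩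
      · change (2 : SkewW q) = _
        simpa [← one_eq_mono] using one_add_one_eq_two.symm
      · rw [coe_nA]; simp [sub_eq_add_neg]
    | succ j ih =>
      refine ⟨by simpa using ih.2, ?_⟩
      obtain ⟨⟨a, ha⟩, b, hb⟩ := ih
      -- Multiplying by `w - w⁻¹` raises the exponent; adding the previous element cancels the terms
      -- `w^(±j)`.
      refine ⟨b * nA q 0 + a, ?_⟩
      simp only [AddMemClass.coe_add, MulMemClass.coe_mul, ha, hb, coe_nA, add_mul, mul_sub,
        smul_mul_assoc, mono_mul]
      norm_num
      rw [show (-1 : ℤ) + (-1 + -j) = -1 + -j + -1 by ring]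
      simp only [pow_succ]
      module
  exact (key j).1

/-! ### The automorphism -/

/-- The embedding of `ℂ(v)`. -/
def monoZeroHom : RatFunc ℂ →ₐ[ℂ] SkewW q where
  toFun f := mono q 0 f
  map_one' := rfl
  map_mul' f g := by rw [mono_mul, shift_zero, add_zero]
  map_zero' := mono_zero q 0
  map_add' f g := mono_add q 0 f g
  commutes' c := by
    rw [Algebra.algebraMap_eq_smul_one, Algebra.algebraMap_eq_smul_one, one_eq_mono, mono_smul,
      RatFunc.smul_eq_C_mul]

/-- The images of the powers of `w` under `w ↦ q ^ μ v ^ (2μ) w`. -/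
def twistPow (μ : ℤ) : PowW q →* SkewW q where
  -- In `(q^μ v^(2μ) w)^i`, moving the factors `v^(2μ)` past `w` contributes `q^(μ i (i-1))`, whence
  -- the exponent `μ i²`.
  toFun i := mono q (Multiplicative.toAdd i)
    (qR q ^ (μ * Multiplicative.toAdd i ^ 2) * RatFunc.X ^ (2 * μ * Multiplicative.toAdd i))
  map_one' := by
    rw [one_eq_mono]
    change mono q 0 (qR q ^ (μ * 0 ^ 2) * RatFunc.X ^ (2 * μ * 0)) = _
    simp
  map_mul' i j := by
    have hX : (RatFunc.X : RatFunc ℂ) ≠ 0 := RatFunc.X_ne_zero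
    change mono q (Multiplicative.toAdd i + Multiplicative.toAdd j)
      (qR q ^ (μ * (Multiplicative.toAdd i + Multiplicative.toAdd j) ^ 2) *
        RatFunc.X ^ (2 * μ * (Multiplicative.toAdd i + Multiplicative.toAdd j))) = _
    generalize Multiplicative.toAdd i = i
    generalize Multiplicative.toAdd j = j
    rw [mono_mul]
    congr 1
    rw [map_mul, map_zpow₀, shift_qR, shift_X_zpow,
      show μ * (i + j) ^ 2 = μ * i ^ 2 + μ * j ^ 2 + i * (2 * μ * j) by ring,
      show 2 * μ * (i + j) = 2 * μ * i + 2 * μ * j by ring]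
    simp only [zpow_add₀ hX, zpow_add₀ (qR_ne_zero q)]
    ring

/-- The endomorphism `v ↦ v`, `w ↦ q ^ μ v ^ (2μ) w`. -/
def twistHom (μ : ℤ) : SkewW q →ₐ[ℂ] SkewW q :=
  SkewMonoidAlgebra.liftNCAlgHom (monoZeroHom q) (twistPow q μ) fun {f i} => by
    change mono q 0 (shift q (Multiplicative.toAdd i) f) * mono q (Multiplicative.toAdd i) _ =
      mono q (Multiplicative.toAdd i) _ * mono q 0 f
    rw [mono_mul, mono_mul, shift_zero, zero_add, add_zero, mul_comm]

theorem twistHom_mono (μ i : ℤ) (f : RatFunc ℂ) : twistHom q μ (mono q i f) =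
    mono q i (f * (qR q ^ (μ * i ^ 2) * RatFunc.X ^ (2 * μ * i))) := by
  have h : twistHom q μ (mono q i f) = mono q 0 f *
      mono q i (qR q ^ (μ * i ^ 2) * RatFunc.X ^ (2 * μ * i)) :=
    SkewMonoidAlgebra.liftNC_single _ _ _ _
  rw [h, mono_mul, shift_zero, zero_add]

theorem twistHom_symA (μ k : ℤ) : twistHom q μ (symA q k) = symA q k := by
  simp [coe_symA, twistHom_mono]

theorem twistHom_monA (μ k : ℤ) :
    twistHom q μ (monA q k) = (qC q ^ μ • monA q (k + 2 * μ) : algA q) := by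
  have hX : (RatFunc.X : RatFunc ℂ) ≠ 0 := RatFunc.X_ne_zero
  simp only [coe_monA, map_add, twistHom_mono, SetLike.val_smul, smul_add, mono_smul, C_zpow]
  norm_num only [mul_one, neg_add, zpow_add₀ hX, mul_neg]
  congr 2 <;> ring

theorem twistHom_mem (μ : ℤ) (a : algA q) : twistHom q μ a ∈ algA q := by
  induction a using algA_induction q with
  | hs k => rw [twistHom_symA]; exact Subtype.property _
  | hm k => rw [twistHom_monA]; exact Subtype.property _
  | hc c =>
    rw [Subalgebra.coe_algebraMap, AlgHom.commutes]
    exact Subalgebra.algebraMap_mem _ _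
  | hadd a b ha hb => rw [AddMemClass.coe_add, map_add]; exact add_mem ha hb
  | hmul a b ha hb => rw [MulMemClass.coe_mul, map_mul]; exact mul_mem ha hb

/-- The endomorphism of `𝒜` with `H_a ↦ H_{a + 2μ}`. -/
def twistA (μ : ℤ) : algA q →ₐ[ℂ] algA q :=
  ((twistHom q μ).comp (algA q).val).codRestrict (algA q) (twistHom_mem q μ)

theorem twistA_symA (μ k : ℤ) : twistA q μ (symA q k) = symA q k :=
  Subtype.ext (twistHom_symA q μ k)

theorem twistA_monA (μ k : ℤ) : twistA q μ (monA q k) = qC q ^ μ • monA q (k + 2 * μ) :=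
  Subtype.ext (twistHom_monA q μ k)

theorem symA_mul (j k : ℤ) : symA q j * symA q k = symA q (j + k) + symA q (j - k) := by
  apply Subtype.ext
  rw [MulMemClass.coe_mul, AddMemClass.coe_add, coe_symA, coe_symA, coe_symA, coe_symA, mono_mul,
    shift_zero, zero_add, symR_mul, mono_add]

theorem symA_neg (k : ℤ) : symA q (-k) = symA q k :=
  Subtype.ext (by rw [coe_symA, coe_symA, symR_neg])

theorem symA_zero : symA q 0 = 2 := Subtype.ext <| by
  change (_ : SkewW q) = 2
  rw [coe_symA, symR, zpow_zero, neg_zero, zpow_zero, mono_add, ← one_eq_mono, one_add_one_eq_two]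

theorem qC_zpow_ne_zero (n : ℤ) : qC q ^ n ≠ 0 := zpow_ne_zero _ (qC_ne_zero q)

theorem qC_zpow_inj {i j : ℤ} (h : qC q ^ i = qC q ^ j) : i = j := by
  have h1 : (q : ℝ) ^ i = (q : ℝ) ^ j := by
    simp only [qC] at h
    exact_mod_cast h
  exact zpow_right_injective₀ q.2.1 q.2.2.ne h1

/-- The `E_k` generate `𝒜`: `monA_commutator` yields `s_1`, since `q² ≠ q⁻²`, and `s_{n+1} = s_n s_1
- s_{n-1}` yields the rest. -/
theorem algHom_ext_monA {B : Type*} [Ring B] [Algebra ℂ B] {φ ψ : algA q →ₐ[ℂ] B}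
    (h : ∀ k, φ (monA q k) = ψ (monA q k)) : φ = ψ := by
  have h1 : φ (symA q 1) = ψ (symA q 1) := by
    have hc := monA_commutator q 0
    have hne : qC q ^ (-0 - 0 - 3 : ℤ) * (qC q ^ 2 - (qC q ^ 2)⁻¹) ≠ 0 := by
      refine mul_ne_zero (qC_zpow_ne_zero q _) (sub_ne_zero.2 fun h => ?_)
      have := @qC_zpow_inj q 2 (-2) (by rw [zpow_neg]; exact_mod_cast h)
      omega
    have h2 := congrArg φ hc
    have h3 := congrArg ψ hc
    simp only [map_sub, map_smul, map_mul, h] at h2 h3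
    rw [h2] at h3
    exact smul_right_injective _ hne h3
  have key : ∀ n : ℕ, φ (symA q n) = ψ (symA q n) ∧ φ (symA q (n + 1)) = ψ (symA q (n + 1)) := by
    intro n
    induction n with
    | zero =>
      refine ⟨?_, by simpa using h1⟩
      rw [Nat.cast_zero, symA_zero, ← one_add_one_eq_two, map_add, map_add, map_one, map_one]
    | succ n ih =>
      refine ⟨by simpa using ih.2, ?_⟩
      have h := symA_mul q (n + 1) 1
      rw [add_sub_cancel_right] at h
      rw [Nat.cast_succ, ← sub_eq_of_eq_add h, map_sub, map_sub, map_mul, map_mul, ih.1, ih.2, h1]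
  apply AlgHom.ext
  intro a
  induction a using algA_induction q with
  | hs k =>
    obtain ⟨n, rfl | rfl⟩ := k.eq_nat_or_neg
    · exact (key n).1
    · rw [symA_neg]; exact (key n).1
  | hm k => exact h k
  | hc c => rw [AlgHom.commutes, AlgHom.commutes]
  | hadd a b ha hb => rw [map_add, map_add, ha, hb]
  | hmul a b ha hb => rw [map_mul, map_mul, ha, hb]

theorem twistA_comp (μ ν : ℤ) (h : μ + ν = 0) :
    (twistA q μ).comp (twistA q ν) = AlgHom.id ℂ (algA q) := by
  apply algHom_ext_monA
  intro k
  obtain rfl : ν = -μ := by omega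
  simp [twistA_monA, smul_smul, inv_mul_cancel₀ (qC_zpow_ne_zero q μ)]

/-- The automorphism of `𝒜` with `H_a ↦ H_{a + 2μ}`. -/
def twistEquiv (μ : ℤ) : algA q ≃ₐ[ℂ] algA q :=
  AlgEquiv.ofAlgHom (twistA q μ) (twistA q (-μ)) (twistA_comp q _ _ (by omega))
    (twistA_comp q _ _ (by omega))

theorem twistEquiv_apply (μ : ℤ) (a : algA q) : twistEquiv q μ a = twistA q μ a := rfl

theorem map_H_iff {m : ℕ} {μ : ℕ} (hm : m = 2 * μ) (g : algA q ≃ₐ[ℂ] algA q) :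
    (∀ a : ℤ, g (H q a) = H q (a + m)) ↔ g = twistEquiv q μ := by
  have hH : ∀ a : ℤ, H q a = (((q : ℝ) ^ ((a : ℝ) / 2) : ℝ) : ℂ) • monA q a := fun _ => rfl
  have hH2 : ∀ a : ℤ, H q (a + m) =
      (((q : ℝ) ^ ((a : ℝ) / 2) : ℝ) : ℂ) • (qC q ^ (μ : ℤ) • monA q (a + 2 * μ)) := by
    intro a
    rw [hH, smul_smul]
    congr 1
    · rw [qC, ← Complex.ofReal_zpow, ← Complex.ofReal_mul]
      congr 1
      rw [← Real.rpow_intCast, ← Real.rpow_add q.2.1]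
      congr 1
      rw [hm]; push_cast; ring
    · rw [hm]; norm_cast
  have hne : ∀ a : ℤ, (((q : ℝ) ^ ((a : ℝ) / 2) : ℝ) : ℂ) ≠ 0 := fun a =>
    Complex.ofReal_ne_zero.2 (Real.rpow_pos_of_pos q.2.1 _).ne'
  constructor
  · intro h
    have h2 : (g : algA q →ₐ[ℂ] algA q) = twistA q μ := by
      apply algHom_ext_monA
      intro k
      have := h k
      rw [hH, hH2, map_smul] at this
      rw [twistA_monA]
      exact smul_right_injective _ (hne k) this
    exact AlgEquiv.ext fun a => DFunLike.congr_fun h2 a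
  · rintro rfl a
    rw [hH, hH2, map_smul, twistEquiv_apply, twistA_monA]

/-! ### Words in the generators -/

/-- The span of all `v ^ k u₊ + v ^ (-k) u₋`. -/
def monSpan : Submodule ℂ (algA q) := Submodule.span ℂ (Set.range (monA q))

/-- The span of all products of a symmetric Laurent polynomial and `n` generators
`v ^ k u₊ + v ^ (-k) u₋`. -/
def words (n : ℕ) : Submodule ℂ (algA q) := symSpanA q * monSpan q ^ n

theorem symA_mem (k : ℤ) : symA q k ∈ symSpanA q := Submodule.subset_span ⟨k, rfl⟩

theorem monA_mem (k : ℤ) : monA q k ∈ monSpan q := Submodule.subset_span ⟨k, rfl⟩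

theorem symSpanA_mul_monSpan : symSpanA q * monSpan q ≤ monSpan q := by
  rw [symSpanA, monSpan, Submodule.span_mul_span, Submodule.span_le]
  rintro _ ⟨_, ⟨j, rfl⟩, _, ⟨k, rfl⟩, rfl⟩
  change symA q j * monA q k ∈ monSpan q
  rw [symA_mul_monA]
  exact add_mem (monA_mem q _) (monA_mem q _)

theorem monSpan_mul_symSpanA : monSpan q * symSpanA q ≤ monSpan q := by
  rw [symSpanA, monSpan, Submodule.span_mul_span, Submodule.span_le]
  rintro _ ⟨_, ⟨k, rfl⟩, _, ⟨j, rfl⟩, rfl⟩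
  change monA q k * symA q j ∈ monSpan q
  rw [monA_mul_symA]
  exact add_mem (Submodule.smul_mem _ _ (monA_mem q _)) (Submodule.smul_mem _ _ (monA_mem q _))

theorem symSpanA_mul_symSpanA : symSpanA q * symSpanA q ≤ symSpanA q := by
  rw [symSpanA, Submodule.span_mul_span, Submodule.span_le]
  rintro _ ⟨_, ⟨k, rfl⟩, _, ⟨j, rfl⟩, rfl⟩
  change symA q k * symA q j ∈ symSpanA q
  rw [symA_mul]
  exact add_mem (symA_mem q _) (symA_mem q _)

theorem one_le_symSpanA : 1 ≤ symSpanA q := by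
  rw [Submodule.one_le]
  have h := Submodule.smul_mem _ (1 / 2 : ℂ) (symA_mem q 0)
  rwa [symA_zero, show (2 : algA q) = (2 : ℂ) • (1 : algA q) by
    rw [two_smul, one_add_one_eq_two], smul_smul,
    one_div_mul_cancel two_ne_zero, one_smul] at h

theorem monSpan_pow_mul_symSpanA (n : ℕ) :
    monSpan q ^ n * symSpanA q ≤ symSpanA q * monSpan q ^ n := by
  cases n with
  | zero => simp
  | succ n =>
    calc monSpan q ^ (n + 1) * symSpanA q = monSpan q ^ n * (monSpan q * symSpanA q) := by
          rw [pow_succ, mul_assoc]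
      _ ≤ monSpan q ^ n * monSpan q := mul_le_mul_right (monSpan_mul_symSpanA q) _
      _ = 1 * monSpan q ^ (n + 1) := by rw [pow_succ, one_mul]
      _ ≤ _ := mul_le_mul_left (one_le_symSpanA q) _

theorem words_mul (i j : ℕ) : words q i * words q j ≤ words q (i + j) :=
  calc words q i * words q j
      = symSpanA q * (monSpan q ^ i * symSpanA q) * monSpan q ^ j := by
        simp only [words, mul_assoc]
    _ ≤ symSpanA q * (symSpanA q * monSpan q ^ i) * monSpan q ^ j :=
        mul_le_mul_left (mul_le_mul_right (monSpan_pow_mul_symSpanA q i) _) _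
    _ = (symSpanA q * symSpanA q) * monSpan q ^ (i + j) := by simp only [pow_add, mul_assoc]
    _ ≤ _ := mul_le_mul_left (symSpanA_mul_symSpanA q) _

theorem monSpan_pow_le_words (n : ℕ) : monSpan q ^ n ≤ words q n := by
  conv_lhs => rw [← one_mul (monSpan q ^ n)]
  exact mul_le_mul_left (one_le_symSpanA q) _

/-- A symmetric prefactor is absorbed by the first letter, so at least one letter is needed. -/
theorem words_succ_le (n : ℕ) : words q (n + 1) ≤ monSpan q ^ (n + 1) := by
  rw [words, pow_succ', ← mul_assoc]
  exact mul_le_mul_left (symSpanA_mul_monSpan q) _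

theorem words_zero : words q 0 = symSpanA q := by simp [words]

theorem mem_iSup_words (a : algA q) : a ∈ ⨆ n, words q n := by
  induction a using algA_induction q with
  | hs k => exact Submodule.mem_iSup_of_mem 0 (by rw [words_zero]; exact symA_mem q k)
  | hm k =>
    exact Submodule.mem_iSup_of_mem 1
      (monSpan_pow_le_words q 1 (by rw [pow_one]; exact monA_mem q k))
  | hc c =>
    refine Submodule.mem_iSup_of_mem 0 ?_
    rw [words_zero, Algebra.algebraMap_eq_smul_one]
    exact Submodule.smul_mem _ _ (Submodule.one_le.1 (one_le_symSpanA q))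
  | hadd a b ha hb => exact add_mem ha hb
  | hmul a b ha hb =>
    have h := Submodule.mul_mem_mul ha hb
    rw [Submodule.iSup_mul] at h
    refine (iSup_le fun i => ?_ : _ ≤ ⨆ n, words q n) h
    rw [Submodule.mul_iSup]
    exact iSup_le fun j => (words_mul q i j).trans (le_iSup (words q) (i + j))

/-! ### Parity -/

/-- The span of the monomials `f w ^ i` with `i` of the same parity as `n`. -/
def parity (n : ℤ) : Submodule ℂ (SkewW q) :=
  Submodule.span ℂ {a | ∃ i f, Even (i + n) ∧ a = mono q i f}

theorem mono_mem_parity {n i : ℤ} (h : Even (i + n)) (f : RatFunc ℂ) : mono q i f ∈ parity q n :=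
  Submodule.subset_span ⟨i, f, h, rfl⟩

theorem parity_mul {n k : ℤ} {a b : SkewW q} (ha : a ∈ parity q n) (hb : b ∈ parity q k) :
    a * b ∈ parity q (n + k) := by
  induction ha using Submodule.span_induction with
  | mem x hx =>
    obtain ⟨i, f, hi, rfl⟩ := hx
    induction hb using Submodule.span_induction with
    | mem y hy =>
      obtain ⟨j, g, hj, rfl⟩ := hy
      rw [mono_mul]
      exact mono_mem_parity q (by rw [add_add_add_comm]; exact hi.add hj) _
    | zero => rw [mul_zero]; exact zero_mem _
    | add x y hx hy h1 h2 => rw [mul_add]; exact add_mem h1 h2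
    | smul c x hx h => rw [mul_smul_comm]; exact Submodule.smul_mem _ _ h
  | zero => rw [zero_mul]; exact zero_mem _
  | add x y hx hy h1 h2 => rw [add_mul]; exact add_mem h1 h2
  | smul c x hx h => rw [smul_mul_assoc]; exact Submodule.smul_mem _ _ h

theorem coeff_eq_zero_of_mem_parity {n i : ℤ} {a : SkewW q} (ha : a ∈ parity q n)
    (hi : ¬ Even (i + n)) : a.coeff (powW q i) = 0 := by
  induction ha using Submodule.span_induction with
  | mem x hx =>
    obtain ⟨j, f, hj, rfl⟩ := hx
    rw [coeff_mono, if_neg]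
    rintro rfl
    exact hi hj
  | zero => simp
  | add x y hx hy h1 h2 => simp [h1, h2]
  | smul c x hx h => simp [h]

theorem monSpan_pow_parity (n : ℕ) {a : algA q} (ha : a ∈ monSpan q ^ n) :
    (a : SkewW q) ∈ parity q n := by
  induction n generalizing a with
  | zero =>
    rw [pow_zero, Submodule.mem_one] at ha
    obtain ⟨c, rfl⟩ := ha
    rw [Algebra.algebraMap_eq_smul_one]
    exact Submodule.smul_mem _ _ (mono_mem_parity q (by simp) 1)
  | succ n ih =>
    rw [pow_succ] at ha
    induction ha using Submodule.mul_induction_on' with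
    | mem_mul_mem x hx y hy =>
      rw [MulMemClass.coe_mul, Nat.cast_succ]
      refine parity_mul q (ih hx) ?_
      induction hy using Submodule.span_induction with
      | mem x hx =>
        obtain ⟨k, rfl⟩ := hx
        rw [coe_monA]
        exact add_mem (mono_mem_parity q (by decide) _) (mono_mem_parity q (by decide) _)
      | zero => exact zero_mem _
      | add x y hx hy h1 h2 => exact add_mem h1 h2
      | smul c x hx h => exact Submodule.smul_mem _ _ h
    | add x hx y hy h1 h2 => exact add_mem h1 h2

theorem symSpanA_coe {a : algA q} (ha : a ∈ symSpanA q) :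
    ∃ f ∈ symSpan, (a : SkewW q) = mono q 0 f := by
  induction ha using Submodule.span_induction with
  | mem x hx =>
    obtain ⟨k, rfl⟩ := hx
    exact ⟨symR k, symR_mem k, rfl⟩
  | zero => exact ⟨0, zero_mem _, (mono_zero q 0).symm⟩
  | add x y hx hy h1 h2 =>
    obtain ⟨f, hf, hf'⟩ := h1
    obtain ⟨g, hg, hg'⟩ := h2
    exact ⟨f + g, add_mem hf hg, by rw [AddMemClass.coe_add, hf', hg', mono_add]⟩
  | smul c x hx h =>
    obtain ⟨f, hf, hf'⟩ := h
    exact ⟨c • f, Submodule.smul_mem _ _ hf, by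
      rw [SetLike.val_smul, hf', mono_smul, RatFunc.smul_eq_C_mul]⟩

theorem words_parity (n : ℕ) {a : algA q} (ha : a ∈ words q n) : (a : SkewW q) ∈ parity q n := by
  induction ha using Submodule.mul_induction_on' with
  | mem_mul_mem x hx y hy =>
    obtain ⟨f, -, hf⟩ := symSpanA_coe q hx
    rw [MulMemClass.coe_mul, ← zero_add (n : ℤ), hf]
    exact parity_mul q (mono_mem_parity q (by simp) f) (monSpan_pow_parity q n hy)
  | add x hx y hy h1 h2 => exact add_mem h1 h2

theorem exists_even_add_odd (a : algA q) : ∃ b ∈ ⨆ n, words q (2 * n),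
    ∃ c ∈ ⨆ n, words q (2 * n + 1), a = b + c := by
  have h : (⨆ n, words q n) ≤ (⨆ n, words q (2 * n)) ⊔ ⨆ n, words q (2 * n + 1) := by
    refine iSup_le fun n => ?_
    obtain ⟨k, rfl | rfl⟩ := n.even_or_odd'
    · exact (le_iSup (fun n => words q (2 * n)) k).trans le_sup_left
    · exact (le_iSup (fun n => words q (2 * n + 1)) k).trans le_sup_right
  obtain ⟨b, hb, c, hc, rfl⟩ := Submodule.mem_sup.1 (h (mem_iSup_words q a))
  exact ⟨b, hb, c, hc, rfl⟩

theorem even_words_parity {a : algA q} (ha : a ∈ ⨆ n, words q (2 * n)) :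
    (a : SkewW q) ∈ parity q 0 := by
  have h : (⨆ n, words q (2 * n)) ≤ (parity q 0).comap (algA q).val.toLinearMap :=
    iSup_le fun n x hx => by
      refine Submodule.span_mono ?_ (words_parity q _ hx)
      rintro _ ⟨i, f, h, rfl⟩
      exact ⟨i, f, by push_cast at h; rw [Int.even_iff] at *; omega, rfl⟩
  exact h ha

theorem odd_words_parity {a : algA q} (ha : a ∈ ⨆ n, words q (2 * n + 1)) :
    (a : SkewW q) ∈ parity q 1 := by
  have h : (⨆ n, words q (2 * n + 1)) ≤ (parity q 1).comap (algA q).val.toLinearMap :=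
    iSup_le fun n x hx => by
      refine Submodule.span_mono ?_ (words_parity q _ hx)
      rintro _ ⟨i, f, h, rfl⟩
      exact ⟨i, f, by push_cast at h; rw [Int.even_iff] at *; omega, rfl⟩
  exact h ha

/-- Words of odd length only involve odd powers of `w`, so the odd-length part of an even element is
zero. -/
theorem IsEvenElt.mem_even_words {a : algA q} (ha : IsEvenElt a) :
    a ∈ ⨆ n, words q (2 * n) := by
  obtain ⟨b, hb, c, hc, rfl⟩ := exists_even_add_odd q a
  suffices h : c = 0 by rwa [h, add_zero]
  apply Subtype.ext
  apply skew_ext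
  intro i
  rcases i.even_or_odd with hi | hi
  · rw [coeff_eq_zero_of_mem_parity q (odd_words_parity q hc)
      (by simpa [Int.even_add_one] using hi)]
    simp
  · have h1 := ha i hi
    rw [wCoeff, AddMemClass.coe_add, SkewMonoidAlgebra.coeff_add, Finsupp.add_apply,
      coeff_eq_zero_of_mem_parity q (even_words_parity q hb)
      (by simpa using hi), zero_add] at h1
    rw [h1]
    simp

/-! ### Twisted traces are determined by few values -/

theorem symR_one : symR 1 = RatFunc.X + RatFunc.X⁻¹ := by simp [symR]

/-- `v ^ s w² + v ^ (-s) w⁻²` in `𝒜`. -/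
def cA (s : ℤ) : algA q := nA q s * nA q 0 + symA q s

theorem nA_mul_nA (a b : ℤ) :
    nA q a * nA q b = qC q ^ b • cA q (a + b) - qC q ^ (-b) • symA q (a - b) := by
  apply Subtype.ext
  have hX : (RatFunc.X : RatFunc ℂ) ≠ 0 := RatFunc.X_ne_zero
  simp only [cA, MulMemClass.coe_mul, AddSubgroupClass.coe_sub, SetLike.val_smul,
    AddMemClass.coe_add, coe_nA, coe_symA, sub_mul, mul_sub, mono_mul, shift_X_zpow, smul_add,
    smul_sub, mono_smul, C_zpow, symR, mono_add]
  norm_num only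
  simp only [sub_eq_add_neg, neg_add, neg_neg, zpow_add₀ hX, zpow_zero, mul_one, neg_mul, one_mul,
    mul_neg, mul_left_comm _ (qR q ^ b), mul_left_comm _ (qR q ^ (-b))]
  abel

/-- Commuting with `v + v⁻¹` annihilates the constant term and multiplies the coefficient at `w²` by
`(1 - q²) q⁻¹ D 1`. The factor `E_0 n_s`, with `n_s = v^s w - v^(-s) w⁻¹`, has coefficient `q^s v^s
/ D 1` there, which explains the scalar `q^(1-s)`; the case `w⁻²` is symmetric. -/
theorem exists_commutator_eq_cA (s : ℤ) :
    ∃ b : algA q, symA q 1 * b - b * symA q 1 = (1 - qC q ^ 2) • cA q s := by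
  refine ⟨(qC q ^ (1 - s)) • (monA q 0 * nA q s), ?_⟩
  apply Subtype.ext
  have hX : (RatFunc.X : RatFunc ℂ) ≠ 0 := RatFunc.X_ne_zero
  have hQ := qR_ne_zero q
  have h1 := D_ne_zero q 1
  have h2 := D_ne_zero q (-1)
  simp only [cA, MulMemClass.coe_mul, AddSubgroupClass.coe_sub, SetLike.val_smul,
    AddMemClass.coe_add, coe_nA, coe_symA, coe_monA, sub_mul, mul_sub, mul_add, add_mul, mono_mul,
    shift_X_zpow, smul_add, smul_sub, mono_smul, C_zpow, map_add,
    mul_smul_comm, smul_mul_assoc, shift_zero, symR]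
  norm_num only
  apply skew_ext
  intro i
  simp only [SkewMonoidAlgebra.coeff_add, SkewMonoidAlgebra.coeff_sub, Finsupp.add_apply,
    Finsupp.sub_apply, coeff_mono, map_sub, map_one, map_pow, C_qC]
  by_cases hi : i = 2
  · subst hi
    norm_num
    simp only [sub_eq_add_neg, zpow_add₀ hQ, zpow_neg, zpow_one]
    field_simp
    simp only [D, zpow_one, zpow_neg]
    norm_cast
    field_simp
    ring
  by_cases hi0 : i = 0
  · subst hi0
    norm_num
    simp only [sub_eq_add_neg, zpow_add₀ hQ, zpow_neg, zpow_one]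
    field_simp
    ring
  by_cases hi2 : i = -2
  · subst hi2
    norm_num
    simp only [sub_eq_add_neg, zpow_add₀ hQ, zpow_neg, zpow_one]
    field_simp
    simp only [D, zpow_one, zpow_neg, neg_neg]
    field_simp
    ring
  simp [Ne.symm hi, Ne.symm hi0, Ne.symm hi2]

theorem monSpan_pow_le_span (n : ℕ) : monSpan q ^ n ≤
    Submodule.span ℂ {a | ∃ l : List ℤ, l.length = n ∧ a = (l.map (monA q)).prod} := by
  induction n with
  | zero =>
    rw [pow_zero, Submodule.one_le]
    exact Submodule.subset_span ⟨[], rfl, rfl⟩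
  | succ n ih =>
    rw [pow_succ']
    refine (mul_le_mul_right ih _).trans ?_
    rw [monSpan, Submodule.span_mul_span, Submodule.span_le]
    rintro _ ⟨_, ⟨k, rfl⟩, _, ⟨l, hl, rfl⟩, rfl⟩
    exact Submodule.subset_span ⟨k :: l, by simp [hl], by simp⟩

section Trace

variable {q} {μ : ℕ} {T : algA q →ₗ[ℂ] ℂ}

theorem trace_symA_comm (hT : IsTwistedTrace (twistEquiv q μ) T)
    (b : algA q) : T (symA q 1 * b) = T (b * symA q 1) := by
  rw [hT, twistEquiv_apply, twistA_symA]

theorem trace_cA (hT : IsTwistedTrace (twistEquiv q μ) T)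
    (s : ℤ) : T (cA q s) = 0 := by
  obtain ⟨b, hb⟩ := exists_commutator_eq_cA q s
  have h := congrArg T hb
  rw [map_sub, trace_symA_comm hT, sub_self, map_smul, smul_eq_mul] at h
  refine (mul_eq_zero.1 h.symm).resolve_left (sub_ne_zero.2 fun h => ?_)
  have := @qC_zpow_inj q 0 2 (by exact_mod_cast h)
  omega

/-- Apply the trace identity to `n_k` and `n_0`, where `g(n_k) = q^μ n_{k+2μ}`. By `nA_mul_nA` and
`trace_cA` only the terms `s_k` and `s_{k+2μ}` survive. -/
theorem trace_symA_add (hT : IsTwistedTrace (twistEquiv q μ) T)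
    (k : ℤ) : T (symA q (k + 2 * μ)) = qC q ^ (k + μ) * T (symA q k) := by
  have hg : twistA q μ (nA q k) = qC q ^ (μ : ℤ) • nA q (k + 2 * μ) := by
    simp only [nA, map_sub, map_smul, twistA_monA, smul_sub, smul_comm (qC q ^ (μ : ℤ))]
    rw [show k + 1 + 2 * (μ : ℤ) = k + 2 * μ + 1 by ring,
      show k - 1 + 2 * (μ : ℤ) = k + 2 * μ - 1 by ring]
  have h := hT (nA q k) (nA q 0)
  rw [twistEquiv_apply, hg, mul_smul_comm, nA_mul_nA, nA_mul_nA, map_smul, map_sub, map_sub,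
    map_smul, map_smul, map_smul, map_smul, trace_cA hT, trace_cA hT] at h
  rw [zero_sub (k + 2 * (μ : ℤ)), symA_neg] at h
  have hq := qC_ne_zero q
  simp only [smul_eq_mul, mul_zero, zero_sub, neg_zero, zpow_zero, one_mul, sub_zero, mul_neg,
    neg_inj] at h
  rw [h, ← mul_assoc, ← mul_assoc, ← zpow_add₀ hq, ← zpow_add₀ hq]
  ring_nf
  simp

/-- The interval `0 ≤ k ≤ μ` is a fundamental domain for the reflection `k ↦ -k` and the translation
by `2μ`. -/
theorem trace_symA_eq_zero (hT : IsTwistedTrace (twistEquiv q μ) T)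
    (h0 : ∀ k : ℕ, k ≤ μ → T (symA q k) = 0) (k : ℤ) :
    T (symA q k) = 0 := by
  have key : ∀ n : ℕ, T (symA q n) = 0 := by
    intro n
    induction n using Nat.strong_induction_on with
    | _ n ih =>
      by_cases hn : n ≤ μ
      · exact h0 n hn
      -- For `μ = 0` there is no translation; instead `T(s_n) = q^n T(s_n)` with `q^n ≠ 1`.
      rcases Nat.eq_zero_or_pos μ with rfl | hμ
      · have h := trace_symA_add hT n
        simp only [Nat.cast_zero, mul_zero, add_zero] at h
        by_contra hne
        have h2 : qC q ^ (n : ℤ) = qC q ^ (0 : ℤ) := by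
          rw [zpow_zero]
          exact mul_right_cancel₀ hne (by rw [← h, one_mul])
        have := qC_zpow_inj q h2
        omega
      · have h := trace_symA_add hT (n - 2 * μ)
        rw [sub_add_cancel] at h
        rw [h]
        -- Since `n > μ > 0`, the absolute value of `n - 2μ` is less than `n`.
        rcases le_total (2 * μ) n with h2 | h2
        · have := ih (n - 2 * μ) (by omega)
          rw [Nat.cast_sub h2] at this
          push_cast at this
          rw [this, mul_zero]
        · have := ih (2 * μ - n) (by omega)
          rw [Nat.cast_sub h2, ← symA_neg, neg_sub] at this
          push_cast at this
          rw [this, mul_zero]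
  obtain ⟨n, rfl | rfl⟩ := k.eq_nat_or_neg
  · exact key n
  · rw [symA_neg]; exact key n

/-- The error term in `monA_swap` replaces two letters by a symmetric polynomial, giving a shorter
word on which `T` vanishes. Thus `E_a E_{b+1}` may be replaced by `q E_{a+1} E_b` under `T`, and
this is iterated. -/
theorem trace_swap {i j : ℕ} (h0 : ∀ a ∈ words q (i + j), T a = 0) {u u' : algA q}
    (hu : u ∈ words q i) (hu' : u' ∈ words q j) (a b : ℤ) :
    T (u * (monA q a * monA q b) * u') =
      qC q ^ b * T (u * (monA q (a + b) * monA q 0) * u') := by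
  have step : ∀ a b : ℤ, T (u * (monA q a * monA q (b + 1)) * u') =
      qC q * T (u * (monA q (a + 1) * monA q b) * u') := by
    intro a b
    obtain ⟨c, hc, hc'⟩ := mem_algA_of_mem_symSpan q
      (Submodule.smul_mem _ (qC q ^ (-b - b - 1)) (chiR_mem q (a + 1 - b - 1)))
    rw [RatFunc.smul_eq_C_mul, C_zpow, ← monA_swap, add_sub_cancel_right] at hc'
    have hmem : u * c * u' ∈ words q (i + j) := by
      refine words_mul q i j (Submodule.mul_mem_mul ?_ hu')
      have h := Submodule.mul_mem_mul hu (show c ∈ words q 0 by rwa [words_zero])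
      simpa using words_mul q i 0 h
    have h := h0 _ hmem
    rw [Subtype.ext hc', mul_sub, sub_mul, map_sub, mul_smul_comm, smul_mul_assoc, map_smul,
      mul_smul_comm, smul_mul_assoc, map_smul, sub_eq_zero, smul_eq_mul, smul_eq_mul] at h
    have hq := qC_ne_zero q
    rw [sub_eq_add_neg, zpow_add₀ hq, mul_assoc (qC q ^ (-b))] at h
    rw [mul_left_cancel₀ (qC_zpow_ne_zero q _) h, zpow_neg, zpow_one, mul_inv_cancel_left₀ hq]
  induction b generalizing a with
  | zero => simp
  | succ n ih =>
    rw [step, ih, zpow_add₀ (qC_ne_zero q), zpow_one, show a + 1 + (n : ℤ) = a + (n + 1) by ring]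
    ring
  | pred n ih =>
    have h := step (a - 1) (-n - 1)
    rw [sub_add_cancel, sub_add_cancel, ih] at h
    have hq := qC_ne_zero q
    rw [eq_comm, ← eq_inv_mul_iff_mul_eq₀ hq] at h
    rw [h, sub_eq_add_neg (-(n : ℤ)), zpow_add₀ hq, zpow_neg_one, show a - 1 + -(n : ℤ) =
      a + (-n + -1) by ring]
    ring

/-- By `trace_swap` all values on words of length `n + 2` are multiples of `τ(s) = T(E_s
E_0^(n+1))`. Commutation with `v + v⁻¹` makes `τ` geometric along steps of 2, and the twisted trace
identity for `E_0` contradicts this unless `τ = 0`. -/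
theorem trace_words_succ (hT : IsTwistedTrace (twistEquiv q μ) T)
    {n : ℕ} (h0 : ∀ a ∈ words q n, T a = 0) :
    ∀ a ∈ words q (n + 2), T a = 0 := by
  have hq := qC_ne_zero q
  have hpow : ∀ j, monA q 0 ^ j ∈ words q j := fun j =>
    monSpan_pow_le_words q j (Submodule.pow_mem_pow _ (monA_mem q 0) j)
  have hword : ∀ l : List ℤ, (l.map (monA q)).prod ∈ words q l.length := fun l => by
    refine monSpan_pow_le_words q _ ?_
    induction l with
    | nil => simp [Submodule.mem_one]
    | cons a l ih =>
      rw [List.map_cons, List.prod_cons, List.length_cons, pow_succ']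
      exact Submodule.mul_mem_mul (monA_mem q a) ih
  set τ : ℤ → ℂ := fun s => T (monA q s * monA q 0 ^ (n + 1)) with hτ
  -- The index `a` travels left through `r + 1` letters, gaining a factor `q^a` at each.
  have hlast : ∀ r p : ℕ, r + p = n → ∀ s a : ℤ,
      T (monA q s * monA q 0 ^ r * monA q a * monA q 0 ^ p) =
        qC q ^ ((r + 1) * a) * τ (s + a) := by
    intro r
    induction r with
    | zero =>
      intro p hp s a
      have h := @trace_swap q T 0 p (by rwa [hp, ← zero_add n] at *) 1 (monA q 0 ^ p)
        (by simpa using hpow 0) (hpow p) s a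
      rw [one_mul, one_mul] at h
      obtain rfl : p = n := by omega
      rw [pow_zero, mul_one, h, hτ, Nat.cast_zero, zero_add, one_mul, mul_assoc, ← pow_succ']
    | succ r ih =>
      intro p hp s a
      have hu : monA q s * monA q 0 ^ r ∈ words q (1 + r) :=
        words_mul q 1 r (Submodule.mul_mem_mul
          (monSpan_pow_le_words q 1 (by rw [pow_one]; exact monA_mem q s)) (hpow r))
      have h := @trace_swap q T (1 + r) p (by rwa [show 1 + r + p = n by omega]) _ _ hu
        (hpow p) 0 a
      have h2 := ih (p + 1) (by omega) s a
      rw [pow_succ (monA q 0) r, ← mul_assoc, mul_assoc (monA q s * monA q 0 ^ r), h, zero_add,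
        ← mul_assoc, mul_assoc _ (monA q 0), ← pow_succ', h2, ← mul_assoc, ← zpow_add₀ hq]
      congr 2
      push_cast
      ring
  have hfirst : ∀ s a : ℤ, T (monA q a * (monA q s * monA q 0 ^ n)) = qC q ^ s * τ (a + s) := by
    intro s a
    have h := hlast 0 n (by omega) a s
    rw [pow_zero, mul_one, Nat.cast_zero, zero_add, one_mul] at h
    rw [← mul_assoc, h]
  have hend : ∀ s a : ℤ, T (monA q s * monA q 0 ^ n * monA q a) =
      qC q ^ ((n + 1) * a) * τ (s + a) := by
    intro s a
    have h := hlast n 0 (by omega) s a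
    rwa [pow_zero, mul_one] at h
  -- Moving `s_1` around `E_{s+1} E_0^(n+1)` gives `τ(s+2) + τ(s) = q^(n+2) τ(s+2) + q^(-n-2) τ(s)`;
  -- then divide by `1 - q^(n+2)`.
  have hrec : ∀ s, τ (s + 2) = qC q ^ (-(n + 2) : ℤ) * τ s := by
    intro s
    have h := trace_symA_comm hT (monA q (s + 1) * monA q 0 ^ (n + 1))
    rw [← mul_assoc, symA_mul_monA, add_mul, map_add, pow_succ, ← mul_assoc, ← mul_assoc,
      ← mul_assoc, mul_assoc (monA q (s + 1) * monA q 0 ^ n), monA_mul_symA, mul_add, map_add,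
      mul_smul_comm, mul_smul_comm, map_smul, map_smul, hend (s + 1) (0 + 1), hend (s + 1) (0 - 1),
      mul_assoc (monA q (s + 1 + 1)), mul_assoc (monA q (s + 1 - 1)), ← pow_succ] at h
    change τ (s + 1 + 1) + τ (s + 1 - 1) = _ at h
    simp only [smul_eq_mul, zero_add, zero_sub, ← mul_assoc, ← zpow_add₀ hq] at h
    rw [add_sub_cancel_right, add_assoc s, one_add_one_eq_two, ← sub_eq_add_neg (s + 1),
      add_sub_cancel_right, show (1 : ℤ) + (n + 1) * 1 = n + 2 by ring,
      show (-1 : ℤ) + (n + 1) * (-1) = -(n + 2) by ring] at h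
    have hne : 1 - qC q ^ (n + 2 : ℤ) ≠ 0 := sub_ne_zero.2 fun h => by
      have := @qC_zpow_inj q 0 (n + 2) (by rw [zpow_zero, ← h])
      omega
    apply mul_left_cancel₀ hne
    have hinv : qC q ^ (n + 2 : ℤ) * qC q ^ (-(n + 2) : ℤ) = 1 := by
      rw [← zpow_add₀ hq, add_neg_cancel, zpow_zero]
    linear_combination h + τ s * hinv
  have hshift : ∀ (k : ℕ) (s : ℤ), τ (s + 2 * k) = qC q ^ (-(n + 2) * k : ℤ) * τ s := by
    intro k
    induction k with
    | zero => simp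
    | succ k ih =>
      intro s
      rw [Nat.cast_succ, show s + 2 * ((k : ℤ) + 1) = s + 2 * k + 2 by ring, hrec, ih, ← mul_assoc,
        ← zpow_add₀ hq]
      congr 2
      ring
  have hτ0 : ∀ s, τ s = 0 := by
    -- Cycling a leading `E_0` gives `q^s τ(s) = q^e τ(s)`, where `μ` in the exponent `e` comes from
    -- `g(E_0)`, `(n + 1) 2μ` from `hend`, and `-(n + 2) μ` from `hshift`.
    have hne : ∀ s : ℤ, s ≠ μ + (n + 1) * (2 * μ) - (n + 2) * μ → τ s = 0 := by
      intro s hs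
      have h := hT (monA q 0) (monA q s * monA q 0 ^ n)
      rw [hfirst, twistEquiv_apply, twistA_monA, mul_smul_comm, map_smul, hend, zero_add, zero_add,
        hshift, smul_eq_mul, ← mul_assoc, ← mul_assoc, ← zpow_add₀ hq, ← zpow_add₀ hq] at h
      by_contra hne
      apply hs
      rw [qC_zpow_inj q (mul_right_cancel₀ hne h)]
      ring
    intro s
    -- At the one exceptional index, `hrec` transfers the vanishing from `s + 2`.
    by_cases hs : s = μ + (n + 1) * (2 * μ) - (n + 2) * μ
    · have h := hrec s
      rw [hne (s + 2) (by omega)] at h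
      exact (mul_eq_zero.1 h.symm).resolve_left (qC_zpow_ne_zero q _)
    · exact hne s hs
  -- Swapping the last two letters of the list turns the final one into `E_0`, shortening the list
  -- while lengthening the tail `E_0^p`.
  have hall : ∀ (k p : ℕ) (l : List ℤ), l.length = k + 1 → k + p = n + 1 →
      T ((l.map (monA q)).prod * monA q 0 ^ p) = 0 := by
    intro k
    induction k with
    | zero =>
      intro p l hl hp
      obtain ⟨s, rfl⟩ := List.length_eq_one_iff.1 hl
      obtain rfl : p = n + 1 := by omega
      simpa using hτ0 s
    | succ k ih =>
      intro p l hl hp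
      obtain ⟨l₁, b, rfl⟩ := (List.eq_nil_or_concat l).resolve_left (by rintro rfl; simp at hl)
      rw [List.length_concat] at hl
      obtain ⟨l₂, a, rfl⟩ := (List.eq_nil_or_concat l₁).resolve_left (by rintro rfl; simp at hl)
      rw [List.length_concat] at hl
      simp only [List.concat_eq_append]
      have h := @trace_swap q T l₂.length p (by rwa [show l₂.length + p = n by omega]) _ _
        (hword l₂) (hpow p) a b
      have h2 := ih (p + 1) (l₂ ++ [a + b]) (by simp; omega) (by omega)
      simp only [List.map_append, List.prod_append, List.map_cons, List.map_nil,
        List.append_assoc, List.prod_singleton] at h2 ⊢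
      rw [pow_succ', ← mul_assoc, mul_assoc (List.prod _)] at h2
      rw [h, h2, mul_zero]
  intro a ha
  replace ha := monSpan_pow_le_span q _ (words_succ_le q (n + 1) ha)
  induction ha using Submodule.span_induction with
  | mem x hx =>
    obtain ⟨l, hl, rfl⟩ := hx
    simpa using hall (n + 1) 0 l hl rfl
  | zero => exact map_zero T
  | add x y hx hy h1 h2 => rw [map_add, h1, h2, add_zero]
  | smul c x hx h => rw [map_smul, h, smul_zero]

/-- A twisted trace that vanishes on `v ^ k + v ^ (-k)`, `0 ≤ k ≤ μ`, vanishes on even elements. -/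
theorem trace_eq_zero_of_isEvenElt (hT : IsTwistedTrace (twistEquiv q μ) T)
    (h0 : ∀ k : ℕ, k ≤ μ → T (symA q k) = 0) {a : algA q} (ha : IsEvenElt a) : T a = 0 := by
  have key : ∀ n, ∀ a ∈ words q (2 * n), T a = 0 := by
    intro n
    induction n with
    | zero =>
      intro a ha
      rw [mul_zero, words_zero] at ha
      have h : symSpanA q ≤ LinearMap.ker T := by
        rw [symSpanA, Submodule.span_le]
        rintro _ ⟨k, rfl⟩
        exact trace_symA_eq_zero hT h0 k
      exact h ha
    | succ n ih => exact trace_words_succ hT ih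
  exact (iSup_le fun n a ha => key n a ha : _ ≤ LinearMap.ker T) (ha.mem_even_words q)

end Trace

/-! ### The space `A₀` -/

/-- `q ^ n + q ^ (-n)`. -/
def bracket (n : ℤ) : ℂ := qC q ^ n + qC q ^ (-n)

theorem bracket_inj {a b : ℤ} (h : bracket q a = bracket q b) : a = b ∨ a = -b := by
  have hq := qC_ne_zero q
  have h2 : (qC q ^ a - qC q ^ b) * (qC q ^ (a + b) - 1) = 0 := by
    have ha := qC_zpow_ne_zero q a
    have hb := qC_zpow_ne_zero q b
    rw [bracket, bracket, zpow_neg, zpow_neg] at h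
    rw [zpow_add₀ hq]
    field_simp at h
    linear_combination h
  rcases mul_eq_zero.1 h2 with h3 | h3
  · exact Or.inl (qC_zpow_inj q (sub_eq_zero.1 h3))
  · have := @qC_zpow_inj q (a + b) 0 (by rw [zpow_zero]; exact sub_eq_zero.1 h3)
    omega

theorem D_mul_D_neg (k : ℤ) : D q k * D q (-k) = symR 2 - RatFunc.C (bracket q (2 * k)) := by
  have hX : (RatFunc.X : RatFunc ℂ) ≠ 0 := RatFunc.X_ne_zero
  have hQ := qR_ne_zero q
  rw [bracket, map_add, C_zpow, C_zpow, symR, D, D, neg_neg, two_mul, neg_add, zpow_add₀ hQ,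
    zpow_add₀ hQ]
  simp only [zpow_neg]
  rw [show (RatFunc.X : RatFunc ℂ) ^ (2 : ℤ) = RatFunc.X ^ 2 from zpow_natCast _ 2]
  have := zpow_ne_zero k hQ
  field_simp
  ring

/-- `1 / (v² + v⁻² - q ^ (2k) - q ^ (-2k))`. -/
def poleR (k : ℤ) : RatFunc ℂ := (symR 2 - RatFunc.C (bracket q (2 * k)))⁻¹

theorem symR_two_sub_ne_zero (k : ℤ) : symR 2 - RatFunc.C (bracket q (2 * k)) ≠ 0 := by
  rw [← D_mul_D_neg]
  exact mul_ne_zero (D_ne_zero q _) (D_ne_zero q _)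

theorem poleR_neg (k : ℤ) : poleR q (-k) = poleR q k := by
  rw [poleR, poleR, ← D_mul_D_neg, ← D_mul_D_neg, neg_neg, mul_comm]

theorem A0_eq : A0 q = symSpan ⊔
    Submodule.span ℂ {F | ∃ k : ℤ, k ≠ 0 ∧
      F = ((RatFunc.X - RatFunc.C (qC q ^ k)) * (RatFunc.X⁻¹ - RatFunc.C (qC q ^ k)))⁻¹} ⊔
    Submodule.span ℂ {F | ∃ k : ℤ, k ≠ 0 ∧
      F = ((RatFunc.X + RatFunc.C (qC q ^ k)) * (RatFunc.X⁻¹ + RatFunc.C (qC q ^ k)))⁻¹} := by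
  rw [A0, symSpan_eq]

theorem symSpan_le_A0 : symSpan ≤ A0 q := by
  rw [A0_eq]
  exact le_sup_left.trans le_sup_left

/-- Division with remainder by a linear polynomial in `v + v⁻¹`. -/
theorem symSpan_div {α : ℂ} (hα : α ≠ 0) (β : ℂ) {f : RatFunc ℂ} (hf : f ∈ symSpan) :
    ∃ g ∈ symSpan, ∃ e : ℂ, f = (RatFunc.C α * symR 1 + RatFunc.C β) * g + RatFunc.C e := by
  rw [symSpan_eq, Subalgebra.mem_toSubmodule] at hf
  induction hf using Algebra.adjoin_induction with
  | mem x hx =>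
    refine ⟨RatFunc.C α⁻¹, C_mem_symSpan _, -β * α⁻¹, ?_⟩
    rw [Set.mem_singleton_iff.1 hx, ← symR_one, add_mul, mul_right_comm, ← map_mul, ← map_mul,
      mul_inv_cancel₀ hα, add_assoc, ← map_add]
    simp
  | algebraMap r => exact ⟨0, zero_mem _, r, by simp [RatFunc.algebraMap_eq_C]⟩
  | add x y hx hy h1 h2 =>
    obtain ⟨g, hg, e, h⟩ := h1
    obtain ⟨g', hg', e', h'⟩ := h2
    exact ⟨g + g', add_mem hg hg', e + e', by rw [h, h', map_add]; ring⟩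
  | mul x y hx hy h1 h2 =>
    obtain ⟨g, hg, e, h⟩ := h1
    obtain ⟨g', hg', e', h'⟩ := h2
    rw [← Subalgebra.mem_toSubmodule, ← symSpan_eq] at hx hy
    refine ⟨g * y + RatFunc.C e * g', add_mem (symSpan_mul hg hy)
      (symSpan_mul (C_mem_symSpan _) hg'), e * e', ?_⟩
    rw [map_mul]
    linear_combination y * h + RatFunc.C e * h'

theorem sub_mul_sub_eq (k : ℤ) :
    (RatFunc.X - RatFunc.C (qC q ^ k)) * (RatFunc.X⁻¹ - RatFunc.C (qC q ^ k)) =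
      RatFunc.C (-qC q ^ k) * symR 1 + RatFunc.C (1 + qC q ^ (2 * k)) := by
  have hX : (RatFunc.X : RatFunc ℂ) ≠ 0 := RatFunc.X_ne_zero
  rw [symR_one, map_neg, map_add, map_one, two_mul, zpow_add₀ (qC_ne_zero q), map_mul]
  field_simp
  ring

theorem add_mul_add_eq (k : ℤ) :
    (RatFunc.X + RatFunc.C (qC q ^ k)) * (RatFunc.X⁻¹ + RatFunc.C (qC q ^ k)) =
      RatFunc.C (qC q ^ k) * symR 1 + RatFunc.C (1 + qC q ^ (2 * k)) := by
  have hX : (RatFunc.X : RatFunc ℂ) ≠ 0 := RatFunc.X_ne_zero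
  rw [symR_one, map_add, map_one, two_mul, zpow_add₀ (qC_ne_zero q), map_mul]
  field_simp
  ring

/-- The poles at `q^(±k)` and those at `-q^(±k)` together make up the denominator of `poleR q k`,
which is a polynomial in `v² + v⁻²`. -/
theorem sub_mul_add_eq (k : ℤ) :
    ((RatFunc.X - RatFunc.C (qC q ^ k)) * (RatFunc.X⁻¹ - RatFunc.C (qC q ^ k))) *
      ((RatFunc.X + RatFunc.C (qC q ^ k)) * (RatFunc.X⁻¹ + RatFunc.C (qC q ^ k))) =
      RatFunc.C (-qC q ^ (2 * k)) * (symR 2 - RatFunc.C (bracket q (2 * k))) := by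
  have hX : (RatFunc.X : RatFunc ℂ) ≠ 0 := RatFunc.X_ne_zero
  have hQ := zpow_ne_zero k (qR_ne_zero q)
  rw [← D_mul_D_neg, D, D, neg_neg, map_neg, C_zpow, C_zpow, two_mul, zpow_add₀ (qR_ne_zero q),
    zpow_neg]
  field_simp
  ring

theorem one_add_zpow_ne_zero (k : ℤ) : (1 + qC q ^ (2 * k) : ℂ) ≠ 0 := by
  have h : (0 : ℝ) < 1 + (q : ℝ) ^ (2 * k) := add_pos one_pos (zpow_pos q.2.1 _)
  rw [qC]
  exact_mod_cast h.ne'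

/-- Multiples of `1 / (v² + v⁻² - q ^ (2k) - q ^ (-2k))` lie in `A₀`. -/
theorem symSpan_mul_poleR_mem {k : ℤ} (hk : k ≠ 0) {f : RatFunc ℂ} (hf : f ∈ symSpan) :
    f * poleR q k ∈ A0 q := by
  have hne := symR_two_sub_ne_zero q k
  have hS := sub_mul_add_eq q k
  have hS1 := sub_mul_sub_eq q k
  have hS2 := add_mul_add_eq q k
  have hm1 : ((RatFunc.X - RatFunc.C (qC q ^ k)) * (RatFunc.X⁻¹ - RatFunc.C (qC q ^ k)))⁻¹ ∈
      A0 q := by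
    rw [A0_eq]
    exact Submodule.mem_sup_left (Submodule.mem_sup_right (Submodule.subset_span ⟨k, hk, rfl⟩))
  have hm2 : ((RatFunc.X + RatFunc.C (qC q ^ k)) * (RatFunc.X⁻¹ + RatFunc.C (qC q ^ k)))⁻¹ ∈
      A0 q := by
    rw [A0_eq]
    exact Submodule.mem_sup_right (Submodule.subset_span ⟨k, hk, rfl⟩)
  set S1 := (RatFunc.X - RatFunc.C (qC q ^ k)) * (RatFunc.X⁻¹ - RatFunc.C (qC q ^ k))
  set S2 := (RatFunc.X + RatFunc.C (qC q ^ k)) * (RatFunc.X⁻¹ + RatFunc.C (qC q ^ k))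
  have hc : RatFunc.C (-qC q ^ (2 * k)) ≠ 0 :=
    (map_ne_zero _).2 (neg_ne_zero.2 (qC_zpow_ne_zero q (2 * k)))
  have hd : RatFunc.C (2 * (1 + qC q ^ (2 * k))) ≠ 0 :=
    (map_ne_zero _).2 (mul_ne_zero two_ne_zero (one_add_zpow_ne_zero q k))
  -- The sum is a nonzero constant, so `1 / (S1 S2)` is a multiple of `1 / S1 + 1 / S2`.
  have hsum : S1 + S2 = RatFunc.C (2 * (1 + qC q ^ (2 * k))) := by
    rw [hS1, hS2, map_neg, two_mul (1 + qC q ^ (2 * k)),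
      map_add _ (1 + qC q ^ (2 * k)) (1 + qC q ^ (2 * k))]
    ring
  have hS12 : S1 * S2 ≠ 0 := by rw [hS]; exact mul_ne_zero hc hne
  have hne1 := left_ne_zero_of_mul hS12
  have hne2 := right_ne_zero_of_mul hS12
  -- Divide `f` by `S1`, then the quotient by `S2`; only constant remainders are left over simple
  -- denominators.
  obtain ⟨g, hg, e, hfe⟩ := symSpan_div (neg_ne_zero.2 (qC_zpow_ne_zero q k))
    (1 + qC q ^ (2 * k)) hf
  obtain ⟨g', hg', e', hge⟩ := symSpan_div (qC_zpow_ne_zero q k) (1 + qC q ^ (2 * k)) hg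
  rw [← hS1] at hfe
  rw [← hS2] at hge
  have hpole : poleR q k = RatFunc.C (-qC q ^ (2 * k)) * (S1⁻¹ * S2⁻¹) := by
    rw [poleR, ← mul_inv, hS, mul_inv, mul_inv_cancel_left₀ hc]
  have hprod : S1⁻¹ * S2⁻¹ = RatFunc.C (2 * (1 + qC q ^ (2 * k)))⁻¹ * (S1⁻¹ + S2⁻¹) := by
    rw [← hsum] at hd
    rw [map_inv₀, ← hsum]
    field_simp
    ring
  have key : f * (S1⁻¹ * S2⁻¹) = g' + e' • S2⁻¹ +
      (e * (2 * (1 + qC q ^ (2 * k)))⁻¹) • (S1⁻¹ + S2⁻¹) := by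
    rw [RatFunc.smul_eq_C_mul, RatFunc.smul_eq_C_mul, map_mul, mul_assoc, ← hprod, hfe, hge]
    field_simp
  rw [hpole, mul_left_comm, key, ← RatFunc.smul_eq_C_mul]
  exact Submodule.smul_mem _ _ (add_mem (add_mem (symSpan_le_A0 q hg') (Submodule.smul_mem _ _ hm2))
    (Submodule.smul_mem _ _ (add_mem hm1 hm2)))

theorem poleR_mul_poleR {j k : ℤ} (h : bracket q (2 * j) ≠ bracket q (2 * k)) :
    poleR q j * poleR q k =
      (bracket q (2 * j) - bracket q (2 * k))⁻¹ • (poleR q j - poleR q k) := by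
  have h1 := symR_two_sub_ne_zero q j
  have h2 := symR_two_sub_ne_zero q k
  have h3 : RatFunc.C (bracket q (2 * j)) - RatFunc.C (bracket q (2 * k)) ≠ 0 := by
    rw [← map_sub]
    exact (map_ne_zero _).2 (sub_ne_zero.2 h)
  rw [poleR, poleR, RatFunc.smul_eq_C_mul, map_inv₀, map_sub]
  field_simp
  ring

/-- Partial fractions for a product of distinct factors. -/
theorem prod_poleR_mem (K : ℕ) : ∏ l ∈ Finset.range K, poleR q (l + 1) ∈
    Submodule.span ℂ (insert 1 {F | ∃ l : ℕ, l < K ∧ F = poleR q (l + 1)}) := by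
  induction K with
  | zero => simp
  | succ K ih =>
    rw [Finset.prod_range_succ]
    have hmono : Submodule.span ℂ (insert 1 {F | ∃ l : ℕ, l < K ∧ F = poleR q (l + 1)}) ≤
        Submodule.span ℂ (insert 1 {F | ∃ l : ℕ, l < K + 1 ∧ F = poleR q (l + 1)}) :=
      Submodule.span_mono (Set.insert_subset_insert fun F ⟨l, hl, h⟩ => ⟨l, by omega, h⟩)
    have hK : poleR q (K + 1) ∈
        Submodule.span ℂ (insert 1 {F | ∃ l : ℕ, l < K + 1 ∧ F = poleR q (l + 1)}) :=
      Submodule.subset_span (Or.inr ⟨K, by omega, rfl⟩)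
    generalize ∏ l ∈ Finset.range K, poleR q (l + 1) = P at ih ⊢
    induction ih using Submodule.span_induction with
    | mem x hx =>
      rcases hx with rfl | ⟨l, hl, rfl⟩
      · rwa [one_mul]
      · rw [poleR_mul_poleR q fun h => by have := bracket_inj q h; omega]
        exact Submodule.smul_mem _ _
          (sub_mem (Submodule.subset_span (Or.inr ⟨l, by omega, rfl⟩)) hK)
    | zero => rw [zero_mul]; exact zero_mem _
    | add x y hx hy h1 h2 => rw [add_mul]; exact add_mem h1 h2
    | smul c x hx h => rw [smul_mul_assoc]; exact Submodule.smul_mem _ _ h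

theorem mem_A0_of_mul_prod_mem {F : RatFunc ℂ} (K : ℕ)
    (h : F * ∏ l ∈ Finset.range K, (symR 2 - RatFunc.C (bracket q (2 * (l + 1)))) ∈ symSpan) :
    F ∈ A0 q := by
  have hne : ∏ l ∈ Finset.range K, (symR 2 - RatFunc.C (bracket q (2 * (l + 1)))) ≠ 0 :=
    Finset.prod_ne_zero_iff.2 fun l _ => symR_two_sub_ne_zero q (l + 1)
  have hinv : ∏ l ∈ Finset.range K, poleR q (l + 1) =
      (∏ l ∈ Finset.range K, (symR 2 - RatFunc.C (bracket q (2 * (l + 1)))))⁻¹ :=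
    Finset.prod_inv_distrib _
  have hp := prod_poleR_mem q K
  rw [hinv] at hp
  rw [← mul_inv_cancel_right₀ hne F]
  set f := F * ∏ l ∈ Finset.range K, (symR 2 - RatFunc.C (bracket q (2 * (l + 1))))
  generalize (∏ l ∈ Finset.range K, (symR 2 - RatFunc.C (bracket q (2 * (l + 1)))))⁻¹ = P at hp ⊢
  induction hp using Submodule.span_induction with
  | mem x hx =>
    rcases hx with rfl | ⟨l, hl, rfl⟩
    · rw [mul_one]; exact symSpan_le_A0 q h
    · exact symSpan_mul_poleR_mem q (by omega) h
  | zero => rw [mul_zero]; exact zero_mem _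
  | add x y hx hy h1 h2 => rw [mul_add]; exact add_mem h1 h2
  | smul c x hx h => rw [mul_smul_comm]; exact Submodule.smul_mem _ _ h

/-! ### The representation on `ℂ(v)` -/

/-- The powers of `w` acting by `f(v) ↦ I ^ i f(q ^ i v)`. -/
def repPow : PowW q →* Module.End ℂ (RatFunc ℂ) where
  toFun i := (Complex.I ^ (Multiplicative.toAdd i)) •
    (shift q (Multiplicative.toAdd i)).toLinearMap
  map_one' := by
    change (Complex.I ^ (0 : ℤ)) • (shift q 0).toLinearMap = _
    rw [zpow_zero, one_smul]
    rfl
  map_mul' i j := by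
    change (Complex.I ^ (Multiplicative.toAdd i + Multiplicative.toAdd j)) •
      (shift q (Multiplicative.toAdd i + Multiplicative.toAdd j)).toLinearMap = _
    generalize Multiplicative.toAdd i = i
    generalize Multiplicative.toAdd j = j
    rw [smul_mul_smul_comm, zpow_add₀ Complex.I_ne_zero]
    congr 1
    apply LinearMap.ext
    intro f
    exact (shift_shift q i j f).symm

/-- The representation of the skew Laurent polynomials on `ℂ(v)`. -/
def rep : SkewW q →ₐ[ℂ] Module.End ℂ (RatFunc ℂ) :=
  SkewMonoidAlgebra.liftNCAlgHom (Algebra.lmul ℂ (RatFunc ℂ)) (repPow q) fun {f i} => by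
    apply LinearMap.ext
    intro h
    change shift q (Multiplicative.toAdd i) f *
      (Complex.I ^ (Multiplicative.toAdd i) • shift q (Multiplicative.toAdd i) h) =
      Complex.I ^ (Multiplicative.toAdd i) • shift q (Multiplicative.toAdd i) (f * h)
    rw [map_mul, mul_smul_comm]

theorem rep_mono (i : ℤ) (f h : RatFunc ℂ) :
    rep q (mono q i f) h = f * (Complex.I ^ i • shift q i h) := by
  have h1 : rep q (mono q i f) = Algebra.lmul ℂ (RatFunc ℂ) f * repPow q (powW q i) :=
    SkewMonoidAlgebra.liftNC_single _ _ _ _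
  rw [h1]
  rfl

/-- The antisymmetric Laurent polynomials. -/
def antiSpan : Submodule ℂ (RatFunc ℂ) := symSpan.map (LinearMap.mulLeft ℂ (D q 0))

theorem mul_mem_antiSpan {f : RatFunc ℂ} (hf : f ∈ symSpan) : D q 0 * f ∈ antiSpan q :=
  ⟨f, hf, rfl⟩

/-- The prefactor `D 0` is shifted to `D 1` or `D (-1)` and cancels the denominators of `E_k`. Since
`w` carries the factor `I` and `w⁻¹` the factor `-I`, the two terms are subtracted and the result is
again antisymmetric. -/
theorem rep_monA_mem (k : ℤ) {h : RatFunc ℂ} (hh : h ∈ antiSpan q) :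
    rep q (monA q k) h ∈ antiSpan q := by
  obtain ⟨f, hf, rfl⟩ := hh
  change rep q (monA q k) (D q 0 * f) ∈ _
  induction hf using Submodule.span_induction with
  | mem x hx =>
    obtain ⟨j, rfl⟩ := hx
    have hX : (RatFunc.X : RatFunc ℂ) ≠ 0 := RatFunc.X_ne_zero
    have h0 := D_ne_zero q 0
    have h1 := D_ne_zero q 1
    have h2 := D_ne_zero q (-1)
    have key : rep q (monA q k) (D q 0 * symR j) = D q 0 *
        (Complex.I • (qC q ^ j • chiR q (k + j) + qC q ^ (-j) • chiR q (k - j))) := by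
      rw [coe_monA, map_add, LinearMap.add_apply, rep_mono, rep_mono, map_mul, map_mul, shift_D,
        shift_D, symR, map_add, map_add, shift_X_zpow, shift_X_zpow, shift_X_zpow, shift_X_zpow]
      simp only [RatFunc.smul_eq_C_mul, C_zpow, chiR, zpow_one, zpow_neg_one, Complex.inv_I,
        map_neg, sub_eq_add_neg, neg_add, neg_neg, zpow_add₀ hX, zero_add, one_mul, neg_mul]
      field_simp
      ring
    rw [key]
    exact mul_mem_antiSpan q (Submodule.smul_mem _ _ (add_mem (Submodule.smul_mem _ _
      (chiR_mem q _)) (Submodule.smul_mem _ _ (chiR_mem q _))))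
  | zero => rw [mul_zero, map_zero]; exact zero_mem _
  | add x y hx hy h1 h2 => rw [mul_add, map_add]; exact add_mem h1 h2
  | smul c x hx h => rw [mul_smul_comm, map_smul]; exact Submodule.smul_mem _ _ h

theorem rep_mem (a : algA q) {h : RatFunc ℂ} (hh : h ∈ antiSpan q) :
    rep q a h ∈ antiSpan q := by
  induction a using algA_induction q generalizing h with
  | hs k =>
    obtain ⟨f, hf, rfl⟩ := hh
    rw [coe_symA, rep_mono, zpow_zero, one_smul, shift_zero]
    change symR k * (D q 0 * f) ∈ _
    rw [mul_left_comm]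
    exact mul_mem_antiSpan q (symSpan_mul (symR_mem k) hf)
  | hm k => exact rep_monA_mem q k hh
  | hc c =>
    rw [Subalgebra.coe_algebraMap, AlgHom.commutes, Module.algebraMap_end_apply]
    exact Submodule.smul_mem _ _ hh
  | hadd a b ha hb => rw [AddMemClass.coe_add, map_add]; exact add_mem (ha hh) (hb hh)
  | hmul a b ha hb => rw [MulMemClass.coe_mul, map_mul]; exact ha (hb hh)

/-- A function of `v` that lies in `𝒜` is a symmetric Laurent polynomial. -/
theorem mem_symSpan_of_coe_eq {a : algA q} {f : RatFunc ℂ} (h : (a : SkewW q) = mono q 0 f) :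
    f ∈ symSpan := by
  have h1 := rep_mem q a (mul_mem_antiSpan q one_mem_symSpan)
  rw [h, rep_mono, zpow_zero, one_smul, shift_zero, mul_one, mul_comm] at h1
  obtain ⟨g, hg, hfg⟩ := h1
  rwa [← mul_left_cancel₀ (D_ne_zero q 0) hfg]

/-! ### The constant coefficients -/

/-- An operator that kills the coefficients at `w ^ (2l)` and `w ^ (-2l)`. -/
def killOp (l : ℤ) (a : algA q) : algA q :=
  a * symA q 1 * symA q 1 - bracket q (2 * l) • (symA q 1 * a * symA q 1) +
    (symA q 1 * (symA q 1 * a) + (bracket q (4 * l) - 2) • a)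

/-- Left multiplication by `v + v⁻¹` multiplies the coefficient at `w^i` by `y = v + v⁻¹`, right
multiplication by `x = q^i v + q^(-i) v⁻¹`. The quadratic form in `x`, `y` is the relation that
these satisfy exactly for `i = ±2l`. -/
theorem coeff_killOp (l i : ℤ) (a : algA q) : wCoeff i (killOp q l a) =
    wCoeff i a * (shift q i (symR 1) ^ 2 - RatFunc.C (bracket q (2 * l)) * symR 1 *
      shift q i (symR 1) + symR 1 ^ 2 + RatFunc.C (bracket q (4 * l)) - 2) := by
  simp only [wCoeff, killOp, AddMemClass.coe_add, AddSubgroupClass.coe_sub, SetLike.val_smul,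
    MulMemClass.coe_mul, coe_symA, SkewMonoidAlgebra.coeff_add, SkewMonoidAlgebra.coeff_sub,
    SkewMonoidAlgebra.coeff_smul, Finsupp.add_apply, Finsupp.sub_apply, Finsupp.smul_apply,
    coeff_mul_mono, coeff_mono_mul, sub_zero, shift_zero, RatFunc.smul_eq_C_mul, map_sub]
  rw [show RatFunc.C (2 : ℂ) = 2 from map_ofNat _ 2]
  ring

theorem coeff_killOp_zero (l : ℤ) (a : algA q) : wCoeff 0 (killOp q l a) =
    (2 - bracket q (2 * l)) • ((symR 2 - RatFunc.C (bracket q (2 * l))) * wCoeff 0 a) := by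
  have h : symR 1 ^ 2 = symR 2 + 2 := by
    have := symR_mul 1 1
    rw [sq, this]
    norm_num [symR]
  have hb : bracket q (4 * l) = bracket q (2 * l) ^ 2 - 2 := by
    have := qC_zpow_ne_zero q (2 * l)
    simp only [bracket, show 4 * l = 2 * l + 2 * l by ring, zpow_neg, zpow_add₀ (qC_ne_zero q)]
    field_simp
    ring
  rw [coeff_killOp, shift_zero, hb, RatFunc.smul_eq_C_mul, map_sub, map_sub, map_pow,
    show RatFunc.C (2 : ℂ) = 2 from map_ofNat _ 2]
  linear_combination wCoeff 0 a * (2 - RatFunc.C (bracket q (2 * l))) * h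

theorem coeff_killOp_self (l i : ℤ) (hi : i = 2 * l ∨ i = -(2 * l)) (a : algA q) :
    wCoeff i (killOp q l a) = 0 := by
  rw [coeff_killOp]
  have hX : (RatFunc.X : RatFunc ℂ) ≠ 0 := RatFunc.X_ne_zero
  have hQ := zpow_ne_zero (2 * l) (qR_ne_zero q)
  have h4 : 4 * l = 2 * l + 2 * l := by ring
  refine mul_eq_zero_of_right _ ?_
  rw [symR_one, map_add, map_inv₀, shift_X, bracket, bracket, map_add, map_add, C_zpow, C_zpow,
    C_zpow, C_zpow, h4, neg_add, zpow_add₀ (qR_ne_zero q), zpow_add₀ (qR_ne_zero q), zpow_neg]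
  rcases hi with rfl | rfl
  · field_simp
    ring
  · rw [zpow_neg]
    field_simp
    ring

/-- Applying `killOp` for `l = K, ..., 1` leaves a pure function of `v` in `𝒜`, hence a symmetric
Laurent polynomial; each application multiplies the constant term by one factor of the product, up
to a nonzero scalar. -/
theorem coeff_zero_mul_prod_mem (K : ℕ) (a : algA q)
    (ha : ∀ i : ℤ, wCoeff i a ≠ 0 → ∃ l : ℕ, l ≤ K ∧ (i = 2 * l ∨ i = -(2 * l))) :
    wCoeff 0 a * ∏ l ∈ Finset.range K, (symR 2 - RatFunc.C (bracket q (2 * (l + 1)))) ∈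
      symSpan := by
  induction K generalizing a with
  | zero =>
    rw [Finset.prod_range_zero, mul_one]
    refine mem_symSpan_of_coe_eq q (a := a) (skew_ext q fun i => ?_)
    rw [coeff_mono]
    split_ifs with h
    · rw [← h]; rfl
    · by_contra hne
      obtain ⟨l, hl, hi⟩ := ha i hne
      omega
  | succ K ih =>
    have h := ih (killOp q (K + 1) a) fun i hi => by
      obtain ⟨l, hl, hl'⟩ := ha i fun h => hi (by rw [coeff_killOp, h, zero_mul])
      refine ⟨l, ?_, hl'⟩
      by_contra hlt
      obtain rfl : l = K + 1 := by omega
      exact hi (coeff_killOp_self q _ _ (by simpa using hl') a)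
    have hne : 2 - bracket q (2 * (K + 1)) ≠ 0 := by
      intro h
      have h0 : bracket q 0 = 2 := by rw [bracket, neg_zero, zpow_zero, one_add_one_eq_two]
      rw [← h0, sub_eq_zero] at h
      have := bracket_inj q h
      omega
    rw [coeff_killOp_zero, smul_mul_assoc, Submodule.smul_mem_iff _ hne] at h
    rw [Finset.prod_range_succ]
    convert h using 1
    ring

/-- The constant coefficient of every element of `𝒜` lies in `A₀`. -/
theorem wCoeff_zero_mem_A0 (a : algA q) : wCoeff 0 a ∈ A0 q := by
  obtain ⟨b, hb, c, hc, rfl⟩ := exists_even_add_odd q a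
  have h0 : wCoeff 0 (b + c) = wCoeff 0 b := by
    rw [wCoeff, AddMemClass.coe_add, SkewMonoidAlgebra.coeff_add, Finsupp.add_apply,
      coeff_eq_zero_of_mem_parity q (odd_words_parity q hc) (by decide), add_zero, wCoeff]
  rw [h0]
  -- Half of this bound would suffice; surplus factors are harmless.
  set K := ((b : SkewW q).support).sup fun i => (Multiplicative.toAdd i).natAbs with hK
  refine mem_A0_of_mul_prod_mem q K (coeff_zero_mul_prod_mem q K b fun i hi => ?_)
  have hi2 : Even i := by
    by_contra h
    exact hi (coeff_eq_zero_of_mem_parity q (even_words_parity q hb) (by simpa using h))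
  obtain ⟨j, rfl⟩ := hi2
  have hle : (j + j).natAbs ≤ K :=
    Finset.le_sup (f := fun i : PowW q => (Multiplicative.toAdd i).natAbs)
      (SkewMonoidAlgebra.mem_support_iff.2 hi)
  exact ⟨j.natAbs, by omega, by omega⟩

/-! ### Every element of `A₀` is a constant coefficient -/

/-- The constant coefficients of the even elements. -/
def evenCoeff : Submodule ℂ (RatFunc ℂ) where
  carrier := {f | ∃ a : algA q, (a : SkewW q) ∈ parity q 0 ∧ wCoeff 0 a = f}
  zero_mem' := ⟨0, zero_mem _, by simp [wCoeff]⟩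
  add_mem' := by
    rintro _ _ ⟨a, ha, rfl⟩ ⟨b, hb, rfl⟩
    exact ⟨a + b, add_mem ha hb, by simp [wCoeff]⟩
  smul_mem' := by
    rintro c _ ⟨a, ha, rfl⟩
    exact ⟨c • a, Submodule.smul_mem _ _ ha, by simp [wCoeff]⟩

theorem symSpan_mul_evenCoeff {f g : RatFunc ℂ} (hf : f ∈ symSpan) (hg : g ∈ evenCoeff q) :
    f * g ∈ evenCoeff q := by
  obtain ⟨a, ha, rfl⟩ := hg
  obtain ⟨b, -, hb⟩ := mem_algA_of_mem_symSpan q hf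
  refine ⟨b * a, ?_, ?_⟩
  · rw [MulMemClass.coe_mul, hb, ← zero_add (0 : ℤ)]
    exact parity_mul q (mono_mem_parity q (by decide) f) ha
  · rw [wCoeff, MulMemClass.coe_mul, hb, coeff_mono_mul, sub_zero, shift_zero, wCoeff]

theorem symSpan_le_evenCoeff : symSpan ≤ evenCoeff q := fun f hf => by
  obtain ⟨b, -, hb⟩ := mem_algA_of_mem_symSpan q hf
  exact ⟨b, hb ▸ mono_mem_parity q (by decide) f, by rw [wCoeff, hb, coeff_mono, if_pos rfl]⟩

theorem monA_parity (k : ℤ) : (monA q k : SkewW q) ∈ parity q 1 := by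
  rw [coe_monA]
  exact add_mem (mono_mem_parity q (by decide) _) (mono_mem_parity q (by decide) _)

/-- The constant term of `E_0²` is `(D 1 + D (-1)) / (D 0 D 1 D (-1))`, and `D 1 + D (-1) = (q +
q⁻¹) D 0`. -/
theorem poleR_one_mem : poleR q 1 ∈ evenCoeff q := by
  have hX : (RatFunc.X : RatFunc ℂ) ≠ 0 := RatFunc.X_ne_zero
  have hQ := qR_ne_zero q
  have h0 := D_ne_zero q 0
  have h1 := D_ne_zero q 1
  have h2 := D_ne_zero q (-1)
  have hb : bracket q 1 ≠ 0 := by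
    have h : (0 : ℝ) < (q : ℝ) ^ (1 : ℤ) + (q : ℝ) ^ (-1 : ℤ) :=
      add_pos (zpow_pos q.2.1 _) (zpow_pos q.2.1 _)
    rw [bracket, qC]
    exact_mod_cast h.ne'
  rw [← Submodule.smul_mem_iff _ hb]
  refine ⟨monA q 0 * monA q 0, ?_, ?_⟩
  · have h := parity_mul q (monA_parity q 0) (monA_parity q 0)
    rw [MulMemClass.coe_mul]
    refine Submodule.span_mono ?_ h
    rintro _ ⟨i, f, hi, rfl⟩
    exact ⟨i, f, by rw [Int.even_iff] at *; omega, rfl⟩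
  · rw [wCoeff, MulMemClass.coe_mul, monA_mul_monA]
    simp only [SkewMonoidAlgebra.coeff_add, Finsupp.add_apply, coeff_mono]
    norm_num
    rw [poleR, ← D_mul_D_neg, RatFunc.smul_eq_C_mul, bracket, map_add, C_zpow, C_zpow]
    field_simp
    simp only [D, zpow_one, zpow_neg, zpow_zero, neg_neg, neg_zero]
    field_simp
    ring

theorem inv_D_mul_add (k : ℤ) : (D q k)⁻¹ * (D q (k + 1))⁻¹ + (D q (-k))⁻¹ * (D q (-(k + 1)))⁻¹ =
    (RatFunc.C (bracket q (2 * k + 1)) * symR 2 - RatFunc.C (2 * bracket q 1)) *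
      (poleR q k * poleR q (k + 1)) := by
  have hX : (RatFunc.X : RatFunc ℂ) ≠ 0 := RatFunc.X_ne_zero
  have hQ := qR_ne_zero q
  have h1 := D_ne_zero q k
  have h2 := D_ne_zero q (-k)
  have h3 := D_ne_zero q (k + 1)
  have h4 := D_ne_zero q (-(k + 1))
  have key : D q (-k) * D q (-(k + 1)) + D q k * D q (k + 1) =
      RatFunc.C (bracket q (2 * k + 1)) * symR 2 - RatFunc.C (2 * bracket q 1) := by
    have hk := zpow_ne_zero k hQ
    rw [map_mul, show RatFunc.C (2 : ℂ) = 2 from map_ofNat _ 2, bracket, bracket, map_add, map_add,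
      C_zpow, C_zpow, C_zpow, C_zpow, symR]
    simp only [D, neg_add, neg_neg, zpow_add₀ hQ, two_mul, zpow_neg, zpow_one]
    rw [show (RatFunc.X : RatFunc ℂ) ^ (2 : ℤ) = RatFunc.X ^ 2 from zpow_natCast _ 2]
    field_simp
    ring
  rw [← key, poleR, poleR, ← D_mul_D_neg, ← D_mul_D_neg]
  field_simp

/-- Conjugating by powers of `w` moves the poles. -/
theorem inv_D_mul_add_mem (j : ℕ) : (D q (j + 1))⁻¹ * (D q (j + 1 + 1))⁻¹ +
    (D q (-(j + 1)))⁻¹ * (D q (-(j + 1 + 1)))⁻¹ ∈ evenCoeff q := by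
  obtain ⟨a, ha⟩ := exists_powW_sym q j
  obtain ⟨b, hb⟩ := exists_powW_sym q (j + 2)
  have hapar : (a : SkewW q) ∈ parity q j := by
    rw [ha]
    exact add_mem (mono_mem_parity q (by rw [Int.even_iff]; omega) _)
      (Submodule.smul_mem _ _ (mono_mem_parity q (by rw [Int.even_iff]; omega) _))
  have hbpar : (b : SkewW q) ∈ parity q j := by
    rw [hb]
    exact add_mem (mono_mem_parity q (by rw [Int.even_iff]; omega) _)
      (Submodule.smul_mem _ _ (mono_mem_parity q (by rw [Int.even_iff]; omega) _))
  have hpar : (a * (monA q 0 * monA q 0) * b : SkewW q) ∈ parity q 0 := by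
    have h := parity_mul q (parity_mul q hapar (parity_mul q (monA_parity q 0) (monA_parity q 0)))
      hbpar
    refine Submodule.span_mono ?_ h
    rintro _ ⟨i, f, hi, rfl⟩
    exact ⟨i, f, by rw [Int.even_iff] at *; omega, rfl⟩
  -- The constant term pairs `w^(±j)` on the left with `w^(∓(j+2))` on the right of the `w^(±2)`
  -- term of `E_0²`. For `j = 0` the two left factors coincide, which doubles the result.
  have hc : (if j = 0 then 2 else (-1) ^ j : ℂ) ≠ 0 := by
    split_ifs
    · exact two_ne_zero
    · exact pow_ne_zero _ (by norm_num)
  rw [← Submodule.smul_mem_iff _ hc]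
  refine ⟨a * (monA q 0 * monA q 0) * b, hpar, ?_⟩
  have hs1 : shift q j ((D q 1)⁻¹ * (D q 2)⁻¹) = (D q (j + 1))⁻¹ * (D q (j + 1 + 1))⁻¹ := by
    rw [map_mul, map_inv₀, map_inv₀, shift_D, shift_D]
    ring_nf
  have hs2 : shift q (-j) ((D q (-1))⁻¹ * (D q (-2))⁻¹) =
      (D q (-(j + 1)))⁻¹ * (D q (-(j + 1 + 1)))⁻¹ := by
    rw [map_mul, map_inv₀, map_inv₀, shift_D, shift_D]
    ring_nf
  rw [← hs1, ← hs2, wCoeff, MulMemClass.coe_mul, MulMemClass.coe_mul, MulMemClass.coe_mul,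
    monA_mul_monA, ha, hb]
  generalize (D q 1)⁻¹ * (D q 2)⁻¹ = A
  generalize (D q (-1))⁻¹ * (D q (-2))⁻¹ = C
  simp only [add_zero, sub_zero, zpow_zero, neg_zero, one_mul, mono_smul, mul_one, mul_add, add_mul,
    mono_mul, SkewMonoidAlgebra.coeff_add, Finsupp.add_apply, coeff_mono, map_one]
  rcases Nat.eq_zero_or_pos j with rfl | hj
  · simp [RatFunc.smul_eq_C_mul, shift_zero]
    rw [show RatFunc.C (2 : ℂ) = 2 from map_ofNat _ 2]
    ring
  · simp [hj.ne', RatFunc.smul_eq_C_mul]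
    rw [if_neg (by omega), if_neg (by omega), if_neg (by omega), if_neg (by omega),
      if_pos (by omega), if_neg (by omega), if_neg (by omega), if_neg (by omega), pow_add]
    ring

theorem linear_mul_inv_mul_inv {x : RatFunc ℂ} {B B' : ℂ} (E e : ℂ) (hb : B' - B ≠ 0)
    (h : x - RatFunc.C B ≠ 0) (h' : x - RatFunc.C B' ≠ 0) :
    (RatFunc.C E * x - RatFunc.C e) * ((x - RatFunc.C B)⁻¹ * (x - RatFunc.C B')⁻¹) =
      ((E * B' - e) / (B' - B)) • (x - RatFunc.C B')⁻¹ -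
      ((E * B - e) / (B' - B)) • (x - RatFunc.C B)⁻¹ := by
  have hC : RatFunc.C (B' - B) ≠ 0 := (map_ne_zero _).2 hb
  rw [RatFunc.smul_eq_C_mul, RatFunc.smul_eq_C_mul, map_div₀, map_div₀]
  field_simp
  simp only [map_sub, map_mul]
  ring

/-- By partial fractions, the element of `inv_D_mul_add_mem` is a combination of two consecutive
`poleR`. The new one has nonzero coefficient, so induction isolates it. -/
theorem poleR_mem (k : ℕ) : poleR q (k + 1) ∈ evenCoeff q := by
  induction k with
  | zero => simpa using poleR_one_mem q
  | succ j ih =>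
    have h := inv_D_mul_add_mem q j
    have hne1 := symR_two_sub_ne_zero q (j + 1)
    have hne2 := symR_two_sub_ne_zero q (j + 1 + 1)
    have hb : bracket q (2 * (j + 1 + 1)) - bracket q (2 * (j + 1)) ≠ 0 := by
      refine sub_ne_zero.2 fun h => ?_
      have := bracket_inj q h
      omega
    rw [inv_D_mul_add] at h
    set B := bracket q (2 * (j + 1))
    set B' := bracket q (2 * (j + 1 + 1)) with hB'
    set E := bracket q (2 * (j + 1) + 1) with hE
    set e := bracket q 1 with he
    -- The product `E B'` expands to `bracket (4 (j + 1) + 3) + bracket 1`, and brackets agree only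
    -- for indices equal up to sign.
    have hα : E * B' - 2 * e ≠ 0 := by
      have hq := qC_ne_zero q
      have h1 : E * B' = bracket q (4 * (j + 1) + 3) + e := by
        simp only [hE, hB', he, bracket, mul_add, add_mul, ← zpow_add₀ hq]
        ring_nf
      rw [h1, two_mul, add_sub_add_right_eq_sub]
      refine sub_ne_zero.2 fun h => ?_
      have := bracket_inj q h
      omega
    have key : (RatFunc.C E * symR 2 - RatFunc.C (2 * e)) *
        (poleR q (j + 1) * poleR q (j + 1 + 1)) =
        ((E * B' - 2 * e) / (B' - B)) • poleR q (j + 1 + 1) -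
        ((E * B - 2 * e) / (B' - B)) • poleR q (j + 1) :=
      linear_mul_inv_mul_inv E (2 * e) hb hne1 hne2
    rw [key] at h
    have h2 := add_mem h (Submodule.smul_mem _ ((E * B - 2 * e) / (B' - B)) ih)
    rw [sub_add_cancel, Submodule.smul_mem_iff _ (div_ne_zero hα hb)] at h2
    exact_mod_cast h2

theorem A0_le_evenCoeff : A0 q ≤ evenCoeff q := by
  have hpole : ∀ k : ℤ, k ≠ 0 → poleR q k ∈ evenCoeff q := by
    intro k hk
    have h := poleR_mem q (k.natAbs - 1)
    rcases k.natAbs_eq with h2 | h2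
    · rwa [show ((k.natAbs - 1 : ℕ) : ℤ) + 1 = k by omega] at h
    · rwa [show ((k.natAbs - 1 : ℕ) : ℤ) + 1 = -k by omega, poleR_neg] at h
  have hsym : ∀ α β : ℂ, RatFunc.C α * symR 1 + RatFunc.C β ∈ symSpan := fun α β =>
    add_mem (symSpan_mul (C_mem_symSpan _) (symR_mem _)) (C_mem_symSpan _)
  have hinv : ∀ (S S' : RatFunc ℂ) (k : ℤ),
      S * S' = RatFunc.C (-qC q ^ (2 * k)) * (symR 2 - RatFunc.C (bracket q (2 * k))) →
      S⁻¹ = (-qC q ^ (2 * k))⁻¹ • (S' * poleR q k) ∧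
      S'⁻¹ = (-qC q ^ (2 * k))⁻¹ • (S * poleR q k) := by
    intro S S' k h
    have hc : RatFunc.C (-qC q ^ (2 * k)) ≠ 0 :=
      (map_ne_zero _).2 (neg_ne_zero.2 (qC_zpow_ne_zero q (2 * k)))
    have hne := symR_two_sub_ne_zero q k
    have hSS : S * S' ≠ 0 := h.trans_ne (mul_ne_zero hc hne)
    have hS := left_ne_zero_of_mul hSS
    have hS' := right_ne_zero_of_mul hSS
    rw [RatFunc.smul_eq_C_mul, RatFunc.smul_eq_C_mul, map_inv₀, poleR]
    constructor <;> field_simp <;> linear_combination -h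
  rw [A0_eq]
  refine sup_le (sup_le (symSpan_le_evenCoeff q) (Submodule.span_le.2 ?_)) (Submodule.span_le.2 ?_)
  · rintro _ ⟨k, hk, rfl⟩
    have h := symSpan_mul_evenCoeff q (hsym (qC q ^ k) (1 + qC q ^ (2 * k))) (hpole k hk)
    rw [← add_mul_add_eq] at h
    rw [SetLike.mem_coe, (hinv _ _ k (sub_mul_add_eq q k)).1]
    exact Submodule.smul_mem _ _ h
  · rintro _ ⟨k, hk, rfl⟩
    have h := symSpan_mul_evenCoeff q (hsym (-qC q ^ k) (1 + qC q ^ (2 * k))) (hpole k hk)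
    rw [← sub_mul_sub_eq] at h
    rw [SetLike.mem_coe, (hinv _ _ k (sub_mul_add_eq q k)).2]
    exact Submodule.smul_mem _ _ h

theorem exists_isEvenElt {F : RatFunc ℂ} (hF : F ∈ A0 q) :
    ∃ a : algA q, IsEvenElt a ∧ wCoeff 0 a = F := by
  obtain ⟨a, ha, h⟩ := A0_le_evenCoeff q hF
  exact ⟨a, fun i hi => coeff_eq_zero_of_mem_parity q ha (by simpa using hi), h⟩

/-! ### Pairing rational functions with holomorphic functions -/

open Filter Topology in
theorem eventually_isSmallRadius (F : RatFunc ℂ) : ∀ᶠ ε in 𝓝[>] (0 : ℝ), IsSmallRadius F ε := by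
  have h1 : ∀ᶠ ε in 𝓝[>] (0 : ℝ), ∀ p ∈ F.denom.roots.toFinset, p ≠ 0 → ε < ‖p‖ := by
    rw [eventually_all_finset]
    intro p _
    rcases eq_or_ne p 0 with rfl | hp
    · simp
    · filter_upwards [nhdsWithin_le_nhds (Iio_mem_nhds (norm_pos_iff.2 hp))] with ε hε _ using hε
  filter_upwards [h1, self_mem_nhdsWithin] with ε h hpos
  refine ⟨hpos, fun p hp hr => h p ?_ hp⟩
  rw [Multiset.mem_toFinset, Polynomial.mem_roots (RatFunc.denom_ne_zero F)]
  exact hr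

theorem IsSmallRadius.denom_ne_zero {F : RatFunc ℂ} {ε : ℝ} (h : IsSmallRadius F ε) {z : ℂ}
    (hz : z ≠ 0) (hle : ‖z‖ ≤ ε) : F.denom.eval₂ (RingHom.id ℂ) z ≠ 0 := fun h0 =>
  (h.2 z hz h0).not_ge hle

/-- The value of a rational function. -/
def ev (F : RatFunc ℂ) (z : ℂ) : ℂ := RatFunc.eval (RingHom.id ℂ) z F

theorem ev_add {F G : RatFunc ℂ} {z : ℂ} (hF : F.denom.eval₂ (RingHom.id ℂ) z ≠ 0)
    (hG : G.denom.eval₂ (RingHom.id ℂ) z ≠ 0) : ev (F + G) z = ev F z + ev G z :=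
  RatFunc.eval_add _ _ hF hG

theorem ev_mul {F G : RatFunc ℂ} {z : ℂ} (hF : F.denom.eval₂ (RingHom.id ℂ) z ≠ 0)
    (hG : G.denom.eval₂ (RingHom.id ℂ) z ≠ 0) : ev (F * G) z = ev F z * ev G z :=
  RatFunc.eval_mul _ _ hF hG

theorem differentiableAt_ev {F : RatFunc ℂ} {z : ℂ} (h : F.denom.eval₂ (RingHom.id ℂ) z ≠ 0) :
    DifferentiableAt ℂ (ev F) z :=
  (Polynomial.differentiableAt F.num).div (Polynomial.differentiableAt F.denom) h

/-- All nonzero poles lie outside the larger circle, so the integrand is holomorphic on the annulus.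
The chosen radius in `pairing` is therefore immaterial. -/
theorem circleIntegral_eq_of_isSmallRadius {ω : ℂ → ℂ} (hω : DifferentiableOn ℂ ω {0}ᶜ)
    {F : RatFunc ℂ} {r R : ℝ} (hr : 0 < r) (hle : r ≤ R) (hR : IsSmallRadius F R) :
    ∮ z in C(0, R), ev F z * ω z / z = ∮ z in C(0, r), ev F z * ω z / z := by
  have hd : ∀ z : ℂ, z ≠ 0 → ‖z‖ ≤ R → DifferentiableAt ℂ (fun z => ev F z * ω z) z :=
    fun z hz hzR => (differentiableAt_ev (hR.denom_ne_zero hz hzR)).mul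
      (hω.differentiableAt (isOpen_compl_singleton.mem_nhds hz))
  have h := Complex.circleIntegral_sub_center_inv_smul_eq_of_differentiable_on_annulus_off_countable
    (c := 0) hr hle (f := fun z => ev F z * ω z) Set.countable_empty ?_ ?_
  · simpa only [sub_zero, smul_eq_mul, inv_mul_eq_div] using h
  · rintro z ⟨hz1, hz2⟩
    refine (hd z ?_ (by simpa using hz1)).continuousAt.continuousWithinAt
    rintro rfl
    simp [hr] at hz2
  · rintro z ⟨⟨hz1, hz2⟩, -⟩
    refine hd z ?_ (by simpa using (Metric.ball_subset_closedBall hz1))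
    rintro rfl
    simp [hr.le] at hz2

/-- The integral of `F ω / z` over a small circle around zero. -/
def pairing (ω : ℂ → ℂ) (F : RatFunc ℂ) : ℂ :=
  ∮ z in C(0, (eventually_isSmallRadius F).exists.choose), ev F z * ω z / z

theorem pairing_eq {ω : ℂ → ℂ} (hω : DifferentiableOn ℂ ω {0}ᶜ) {F : RatFunc ℂ} {ε : ℝ}
    (h : IsSmallRadius F ε) : pairing ω F = ∮ z in C(0, ε), ev F z * ω z / z := by
  have h2 := (eventually_isSmallRadius F).exists.choose_spec
  rcases le_total ε (eventually_isSmallRadius F).exists.choose with h3 | h3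
  · exact circleIntegral_eq_of_isSmallRadius hω h.1 h3 h2
  · exact (circleIntegral_eq_of_isSmallRadius hω h2.1 h3 h).symm

theorem circleIntegrable_ev {ω : ℂ → ℂ} (hω : DifferentiableOn ℂ ω {0}ᶜ) {F : RatFunc ℂ} {ε : ℝ}
    (h : IsSmallRadius F ε) : CircleIntegrable (fun z => ev F z * ω z / z) 0 ε := by
  refine ContinuousOn.circleIntegrable h.1.le fun z hz => ?_
  have hz' : ‖z‖ = ε := by simpa using hz
  have hz0 : z ≠ 0 := norm_pos_iff.1 (hz' ▸ h.1)
  exact (((differentiableAt_ev (h.denom_ne_zero hz0 hz'.le)).mul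
      (hω.differentiableAt (isOpen_compl_singleton.mem_nhds hz0))).div
      differentiableAt_id hz0).continuousAt.continuousWithinAt

theorem circleIntegral_congr_pos {f g : ℂ → ℂ} {ε : ℝ} (hε : 0 < ε)
    (h : ∀ z : ℂ, z ≠ 0 → ‖z‖ = ε → f z = g z) :
    ∮ z in C(0, ε), f z = ∮ z in C(0, ε), g z :=
  circleIntegral.integral_congr hε.le fun z hz => by
    have hz' : ‖z‖ = ε := by simpa using hz
    exact h z (norm_pos_iff.1 (hz' ▸ hε)) hz'

theorem pairing_add {ω : ℂ → ℂ} (hω : DifferentiableOn ℂ ω {0}ᶜ) (F G : RatFunc ℂ) :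
    pairing ω (F + G) = pairing ω F + pairing ω G := by
  obtain ⟨ε, h1, h2, h3⟩ := ((eventually_isSmallRadius F).and
    ((eventually_isSmallRadius G).and (eventually_isSmallRadius (F + G)))).exists
  rw [pairing_eq hω h1, pairing_eq hω h2, pairing_eq hω h3,
    ← circleIntegral.integral_add (circleIntegrable_ev hω h1) (circleIntegrable_ev hω h2)]
  refine circleIntegral_congr_pos h1.1 fun z hz hzε => ?_
  rw [ev_add (h1.denom_ne_zero hz hzε.le) (h2.denom_ne_zero hz hzε.le)]
  ring

theorem pairing_smul {ω : ℂ → ℂ} (hω : DifferentiableOn ℂ ω {0}ᶜ) (c : ℂ) (F : RatFunc ℂ) :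
    pairing ω (c • F) = c * pairing ω F := by
  obtain ⟨ε, h1, h2⟩ := ((eventually_isSmallRadius F).and
    (eventually_isSmallRadius (c • F))).exists
  rw [pairing_eq hω h1, pairing_eq hω h2, ← circleIntegral.integral_const_mul]
  refine circleIntegral_congr_pos h1.1 fun z hz hzε => ?_
  rw [RatFunc.smul_eq_C_mul, ev_mul (by simp) (h1.denom_ne_zero hz hzε.le),
    show ev (RatFunc.C c) z = c from RatFunc.eval_C _ _]
  ring

/-- The pairing with `ω` as a linear functional on rational functions. -/
def pairingHom {ω : ℂ → ℂ} (hω : DifferentiableOn ℂ ω {0}ᶜ) : RatFunc ℂ →ₗ[ℂ] ℂ where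
  toFun := pairing ω
  map_add' := pairing_add hω
  map_smul' := pairing_smul hω

theorem pairing_add_left {ω ω' : ℂ → ℂ} (hω : DifferentiableOn ℂ ω {0}ᶜ)
    (hω' : DifferentiableOn ℂ ω' {0}ᶜ) (F : RatFunc ℂ) :
    pairing (ω + ω') F = pairing ω F + pairing ω' F := by
  obtain ⟨ε, h⟩ := (eventually_isSmallRadius F).exists
  rw [pairing_eq hω h, pairing_eq hω' h, pairing_eq (hω.add hω') h,
    ← circleIntegral.integral_add (circleIntegrable_ev hω h) (circleIntegrable_ev hω' h)]
  refine circleIntegral_congr_pos h.1 fun z _ _ => ?_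
  rw [Pi.add_apply]
  ring

theorem pairing_smul_left {ω : ℂ → ℂ} (hω : DifferentiableOn ℂ ω {0}ᶜ) (c : ℂ) (F : RatFunc ℂ) :
    pairing (c • ω) F = c * pairing ω F := by
  obtain ⟨ε, h⟩ := (eventually_isSmallRadius F).exists
  rw [pairing_eq hω h, pairing_eq (hω.const_smul c) h, ← circleIntegral.integral_const_mul]
  refine circleIntegral_congr_pos h.1 fun z _ _ => ?_
  rw [Pi.smul_apply, smul_eq_mul]
  ring

/-! ### Substitutions -/

/-- `RatFunc.eval` uses the reduced fraction; its denominator divides `d`, so any fraction whose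
denominator is nonzero at `z` gives the same value. -/
theorem ev_eq_div {F : RatFunc ℂ} {p d : Polynomial ℂ} {z : ℂ} (hd : d.eval z ≠ 0)
    (h : F * algebraMap _ _ d = algebraMap _ _ p) : ev F z = p.eval z / d.eval z := by
  have hd0 : d ≠ 0 := by
    rintro rfl
    simp at hd
  have hF : F = algebraMap _ _ p / algebraMap _ _ d :=
    eq_div_of_mul_eq (RatFunc.algebraMap_ne_zero hd0) h
  have hdvd : F.denom ∣ d := (RatFunc.denom_dvd hd0).2 ⟨p, hF⟩
  have hFd : F.denom.eval₂ (RingHom.id ℂ) z ≠ 0 := by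
    obtain ⟨e, rfl⟩ := hdvd
    rw [Polynomial.eval_mul] at hd
    exact left_ne_zero_of_mul hd
  have h2 := congrArg (RatFunc.eval (RingHom.id ℂ) z) h
  rw [RatFunc.eval_mul _ _ hFd (by simp)] at h2
  simp only [RatFunc.eval_algebraMap, Algebra.algebraMap_self, RingHom.id_apply] at h2
  exact (eq_div_iff hd).2 h2

theorem shift_algebraMap (i : ℤ) (p : Polynomial ℂ) :
    shift q i (algebraMap _ _ p) =
      algebraMap _ _ (p.comp (Polynomial.C (qC q ^ i) * Polynomial.X)) := by
  induction p using Polynomial.induction_on' with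
  | add p r hp hr => simp only [map_add, hp, hr, Polynomial.add_comp]
  | monomial n a =>
    rw [← Polynomial.C_mul_X_pow_eq_monomial]
    simp only [map_mul, map_pow, Polynomial.mul_comp, Polynomial.C_comp, Polynomial.pow_comp,
      Polynomial.X_comp, RatFunc.algebraMap_C, RatFunc.algebraMap_X, shift_C, shift_X, C_zpow]

theorem ev_shift (i : ℤ) {F : RatFunc ℂ} {z : ℂ}
    (h : F.denom.eval₂ (RingHom.id ℂ) (qC q ^ i * z) ≠ 0) :
    ev (shift q i F) z = ev F (qC q ^ i * z) := by
  have hev : ∀ p : Polynomial ℂ, (p.comp (Polynomial.C (qC q ^ i) * Polynomial.X)).eval z =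
      p.eval (qC q ^ i * z) := fun p => by simp [Polynomial.eval_comp]
  rw [ev_eq_div (p := F.num.comp (Polynomial.C (qC q ^ i) * Polynomial.X))
    (d := F.denom.comp (Polynomial.C (qC q ^ i) * Polynomial.X)), hev, hev]
  · rfl
  · rw [hev]
    exact h
  · rw [← shift_algebraMap, ← shift_algebraMap, ← map_mul]
    congr 1
    rw [← eq_div_iff (RatFunc.algebraMap_ne_zero (RatFunc.denom_ne_zero F)), RatFunc.num_div_denom]

theorem circleIntegral_comp_mul {c : ℝ} (hc : c ≠ 0) (R : ℝ) (f : ℂ → ℂ) :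
    ∮ z in C(0, R), f (c * z) / z = ∮ z in C(0, c * R), f z / z := by
  rw [circleIntegral, circleIntegral]
  refine intervalIntegral.integral_congr fun θ _ => ?_
  have h : circleMap 0 (c * R) θ = c * circleMap 0 R θ := by
    simp [circleMap, mul_assoc]
  have hc' : (c : ℂ) ≠ 0 := Complex.ofReal_ne_zero.2 hc
  simp only [deriv_circleMap, h, smul_eq_mul]
  field_simp

/-- The substitution `z ↦ q^i z` preserves `dz / z` and scales the circle; both circles can be taken
small, so no residue appears. -/
theorem pairing_shift {ω : ℂ → ℂ} (hω : DifferentiableOn ℂ ω {0}ᶜ) (i : ℤ) (F : RatFunc ℂ) :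
    pairing ω (shift q i F) = pairing (fun z => ω (qC q ^ (-i) * z)) F := by
  have hq : (0 : ℝ) < (q : ℝ) ^ i := zpow_pos q.2.1 _
  have hqC : qC q ^ i = (((q : ℝ) ^ i : ℝ) : ℂ) := by simp [qC]
  have hω' : DifferentiableOn ℂ (fun z => ω (qC q ^ (-i) * z)) {0}ᶜ := by
    refine hω.comp (by fun_prop) fun z hz => ?_
    exact mul_ne_zero (qC_zpow_ne_zero q _) hz
  obtain ⟨ε, h1, h2⟩ : ∃ ε, IsSmallRadius (shift q i F) ε ∧ IsSmallRadius F ((q : ℝ) ^ i * ε) := by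
    have ht : Filter.Tendsto (fun ε : ℝ => (q : ℝ) ^ i * ε) (nhdsWithin 0 (Set.Ioi 0))
        (nhdsWithin 0 (Set.Ioi 0)) := by
      refine tendsto_nhdsWithin_iff.2 ⟨?_, ?_⟩
      · exact ((continuous_const.mul continuous_id).tendsto' 0 0 (by simp)).mono_left
          nhdsWithin_le_nhds
      · filter_upwards [self_mem_nhdsWithin] with x hx using mul_pos hq hx
    exact ((eventually_isSmallRadius _).and (ht.eventually (eventually_isSmallRadius F))).exists
  rw [pairing_eq hω h1, pairing_eq hω' h2,
    ← circleIntegral_comp_mul hq.ne' ε fun z => ev F z * ω (qC q ^ (-i) * z)]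
  refine circleIntegral_congr_pos h1.1 fun z hz hzε => ?_
  rw [ev_shift, ← hqC, ← mul_assoc (qC q ^ (-i)), ← zpow_add₀ (qC_ne_zero q), neg_add_cancel,
    zpow_zero, one_mul]
  refine h2.denom_ne_zero (mul_ne_zero (qC_zpow_ne_zero q _) hz) ?_
  rw [hqC, norm_mul, Complex.norm_real, Real.norm_of_nonneg hq.le, hzε]

theorem pairing_mul_zpow {ω : ℂ → ℂ} (hω : DifferentiableOn ℂ ω {0}ᶜ) (F : RatFunc ℂ) (c : ℂ)
    (n : ℤ) : pairing ω (F * (RatFunc.C c * RatFunc.X ^ n)) =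
      pairing (fun z => c * z ^ n * ω z) F := by
  have hzn : DifferentiableOn ℂ (fun z : ℂ => z ^ n) {0}ᶜ := fun z hz =>
    (differentiableAt_zpow.2 (Or.inl hz)).differentiableWithinAt
  have hω' : DifferentiableOn ℂ (fun z => c * z ^ n * ω z) {0}ᶜ :=
    (hzn.const_mul c).mul hω
  obtain ⟨ε, h1, h2, h3⟩ := ((eventually_isSmallRadius F).and
    ((eventually_isSmallRadius (RatFunc.C c * RatFunc.X ^ n)).and
    (eventually_isSmallRadius (F * (RatFunc.C c * RatFunc.X ^ n))))).exists
  rw [pairing_eq hω h3, pairing_eq hω' h1]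
  refine circleIntegral_congr_pos h1.1 fun z hz hzε => ?_
  have hev : ev (RatFunc.C c * RatFunc.X ^ n) z = c * z ^ n := by
    have hX : (RatFunc.X : RatFunc ℂ) ≠ 0 := RatFunc.X_ne_zero
    obtain ⟨k, rfl | rfl⟩ := n.eq_nat_or_neg
    · rw [ev_eq_div (p := Polynomial.C c * Polynomial.X ^ k) (d := 1)] <;> simp
    · rw [ev_eq_div (p := Polynomial.C c) (d := Polynomial.X ^ k)]
      · simp [div_eq_mul_inv]
      · simpa using fun h : z = 0 => absurd h hz
      · simp [hX]
  rw [ev_mul (h1.denom_ne_zero hz hzε.le) (h2.denom_ne_zero hz hzε.le), hev]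
  ring

/-! ### Twisted traces from quasi-periodic functions -/

theorem mem_quasiPeriodic_iff (μ : ℕ) (ω : ℂ → ℂ) : ω ∈ quasiPeriodic q (2 * μ) ↔
    DifferentiableOn ℂ ω {0}ᶜ ∧ ω 0 = 0 ∧ (∀ z : ℂ, z ≠ 0 → ω z⁻¹ = ω z) ∧
      ∀ z : ℂ, z ≠ 0 → qC q ^ (μ : ℤ) * z ^ (2 * μ : ℤ) * ω (qC q * z) = ω z := by
  have hq := qC_ne_zero q
  have h : (((q : ℝ) ^ (-((2 * μ : ℕ) : ℝ) / 2) : ℝ) : ℂ) = qC q ^ (-(μ : ℤ)) := by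
    rw [show -((2 * μ : ℕ) : ℝ) / 2 = ((-(μ : ℤ) : ℤ) : ℝ) by push_cast; ring,
      Real.rpow_intCast, qC, Complex.ofReal_zpow]
  change (_ ∧ _ ∧ _ ∧ _) ↔ _
  rw [h]
  refine and_congr_right fun _ => and_congr_right fun _ => and_congr_right fun _ =>
    forall_congr' fun z => forall_congr' fun hz => ?_
  have h1 : qC q ^ (μ : ℤ) ≠ 0 := zpow_ne_zero _ hq
  have h2 : z ^ (2 * μ : ℤ) ≠ 0 := zpow_ne_zero _ hz
  rw [zpow_neg, Nat.cast_mul, Nat.cast_ofNat, zpow_neg]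
  constructor
  · intro h
    rw [h]
    field_simp
  · intro h
    rw [← h]
    field_simp

variable {q}

/-- The multiplier is the coefficient by which `twistPow` twists `w^i`; this match is what makes `ω`
produce a `g`-twisted trace. -/
theorem quasiPeriodic_zpow {μ : ℕ} {ω : ℂ → ℂ} (hω : ω ∈ quasiPeriodic q (2 * μ)) (i : ℤ) {z : ℂ}
    (hz : z ≠ 0) : qC q ^ (μ * i ^ 2 : ℤ) * z ^ (2 * μ * i : ℤ) * ω (qC q ^ i * z) = ω z := by
  have hq := qC_ne_zero q
  have h := ((mem_quasiPeriodic_iff q μ ω).1 hω).2.2.2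
  have hnat : ∀ (n : ℕ) (z : ℂ), z ≠ 0 →
      qC q ^ (μ * n ^ 2 : ℤ) * z ^ (2 * μ * n : ℤ) * ω (qC q ^ n * z) = ω z := by
    intro n
    induction n with
    | zero => intro z _; simp
    | succ n ih =>
      intro z hz
      rw [← ih z hz, ← h (qC q ^ n * z) (mul_ne_zero (pow_ne_zero _ hq) hz), mul_zpow,
        show (μ * ((n + 1 : ℕ) : ℤ) ^ 2 : ℤ) = μ * n ^ 2 + μ + n * (2 * μ) by push_cast; ring,
        show (2 * μ * ((n + 1 : ℕ) : ℤ) : ℤ) = 2 * μ * n + 2 * μ by push_cast; ring,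
        zpow_add₀ hq, zpow_add₀ hq, zpow_add₀ hz, zpow_mul (qC q) (n : ℤ), zpow_natCast (qC q) n,
        pow_succ' (qC q) n, mul_assoc (qC q) (qC q ^ n) z]
      ring
  obtain ⟨n, rfl | rfl⟩ := i.eq_nat_or_neg
  · simpa using hnat n z hz
  · have hqn := pow_ne_zero n hq
    rw [← hnat n (qC q ^ (-n : ℤ) * z) (mul_ne_zero (zpow_ne_zero _ hq) hz), mul_zpow, neg_sq,
      ← mul_assoc (qC q ^ n), zpow_neg, zpow_natCast, mul_inv_cancel₀ hqn, one_mul, mul_neg,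
      zpow_neg z, inv_zpow, ← zpow_natCast, ← zpow_mul,
      show (n * (2 * μ * n) : ℤ) = μ * n ^ 2 + μ * n ^ 2 by ring, zpow_add₀ hq]
    have h1 : qC q ^ (μ * n ^ 2 : ℤ) ≠ 0 := zpow_ne_zero _ hq
    have h2 : z ^ (2 * μ * n : ℤ) ≠ 0 := zpow_ne_zero _ hz
    field_simp

theorem pairing_shift_mul {μ : ℕ} {ω : ℂ → ℂ} (hω : ω ∈ quasiPeriodic q (2 * μ)) (i : ℤ)
    (F : RatFunc ℂ) :
    pairing ω (shift q (-i) (F * (qR q ^ (μ * i ^ 2 : ℤ) * RatFunc.X ^ (2 * μ * i : ℤ)))) =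
      pairing ω F := by
  have hd := ((mem_quasiPeriodic_iff q μ ω).1 hω).1
  have hd' : DifferentiableOn ℂ (fun z => ω (qC q ^ i * z)) {0}ᶜ := by
    refine hd.comp (by fun_prop) fun z hz => ?_
    exact mul_ne_zero (qC_zpow_ne_zero q _) hz
  rw [pairing_shift q hd, neg_neg, ← C_zpow, pairing_mul_zpow hd']
  refine circleIntegral_congr_pos (eventually_isSmallRadius F).exists.choose_spec.1 fun z hz _ => ?_
  simp only [quasiPeriodic_zpow hω i hz]

variable (q) in
/-- The functional `∑ f_i w ^ i ↦ ∮ f_0 ω dz / z`. -/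
def skewTrace {ω : ℂ → ℂ} (hω : DifferentiableOn ℂ ω {0}ᶜ) : SkewW q →ₗ[ℂ] ℂ where
  toFun a := pairing ω (a.coeff (powW q 0))
  map_add' a b := by
    rw [SkewMonoidAlgebra.coeff_add, Finsupp.add_apply, pairing_add hω]
  map_smul' c a := by
    rw [SkewMonoidAlgebra.coeff_smul, Finsupp.smul_apply, pairing_smul hω, RingHom.id_apply,
      smul_eq_mul]

theorem skewTrace_mono {ω : ℂ → ℂ} (hω : DifferentiableOn ℂ ω {0}ᶜ) (i : ℤ) (f : RatFunc ℂ) :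
    skewTrace q hω (mono q i f) = if i = 0 then pairing ω f else 0 := by
  change pairing ω ((mono q i f).coeff (powW q 0)) = _
  rw [coeff_mono]
  split_ifs
  · rfl
  · exact (pairingHom hω).map_zero

/-- The identity holds on the whole skew Laurent algebra, since a small circle never meets a pole
under rescaling. On monomials only `w^i` against `w^(-i)` contributes, and `pairing_shift_mul`
applies. -/
theorem skewTrace_mul {μ : ℕ} {ω : ℂ → ℂ} (hω : ω ∈ quasiPeriodic q (2 * μ)) (a b : SkewW q) :
    skewTrace q hω.1 (a * b) = skewTrace q hω.1 (b * twistHom q μ a) := by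
  induction a using skew_induction q with
  | h0 => simp
  | hadd a a' ha ha' => rw [add_mul, map_add, ha, ha', map_add, mul_add, map_add]
  | hm i f =>
    induction b using skew_induction q with
    | h0 => simp
    | hadd b b' hb hb' => rw [add_mul, map_add, ← hb, ← hb', mul_add, map_add]
    | hm j g =>
      rw [mono_mul, twistHom_mono, mono_mul, skewTrace_mono, skewTrace_mono, add_comm j i]
      split_ifs with hij
      · obtain rfl : j = -i := by omega
        rw [← pairing_shift_mul hω i, mul_right_comm, map_mul _ _ (shift q i g), shift_shift,
          neg_add_cancel, shift_zero, mul_comm g]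
      · rfl

/-- The twisted trace on `𝒜` attached to a quasi-periodic function. -/
def quasiTrace {μ : ℕ} {ω : ℂ → ℂ} (hω : ω ∈ quasiPeriodic q (2 * μ)) : algA q →ₗ[ℂ] ℂ :=
  (skewTrace q hω.1).comp (algA q).val.toLinearMap

theorem quasiTrace_apply {μ : ℕ} {ω : ℂ → ℂ} (hω : ω ∈ quasiPeriodic q (2 * μ)) (a : algA q) :
    quasiTrace hω a = pairing ω (wCoeff 0 a) := rfl

theorem quasiTrace_isTwistedTrace {μ : ℕ} {ω : ℂ → ℂ} (hω : ω ∈ quasiPeriodic q (2 * μ)) :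
    IsTwistedTrace (twistEquiv q μ) (quasiTrace hω) := fun a b =>
  skewTrace_mul hω (a : SkewW q) b

theorem quasiTrace_symA {μ : ℕ} {ω : ℂ → ℂ} (hω : ω ∈ quasiPeriodic q (2 * μ)) (k : ℤ) :
    quasiTrace hω (symA q k) = pairing ω (symR k) := by
  rw [quasiTrace_apply, wCoeff, coe_symA, coeff_mono, if_pos rfl]

/-! ### Moments -/

theorem X_zpow_mul_algebraMap (n : ℤ) : ∃ j k : ℕ, (n : ℤ) = j - k ∧
    (RatFunc.X : RatFunc ℂ) ^ n * algebraMap _ _ (Polynomial.X ^ k : Polynomial ℂ) =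
      algebraMap _ _ (Polynomial.X ^ j : Polynomial ℂ) := by
  have hX : (RatFunc.X : RatFunc ℂ) ≠ 0 := RatFunc.X_ne_zero
  obtain ⟨k, rfl | rfl⟩ := n.eq_nat_or_neg
  · exact ⟨k, 0, by simp, by simp⟩
  · exact ⟨0, k, by simp, by simp [hX]⟩

theorem ev_X_zpow (n : ℤ) {z : ℂ} (hz : z ≠ 0) : ev (RatFunc.X ^ n) z = z ^ n := by
  obtain ⟨j, k, rfl, h⟩ := X_zpow_mul_algebraMap n
  rw [ev_eq_div _ h]
  · simp [zpow_sub₀ hz]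
  · simpa using fun h : z = 0 => absurd h hz

theorem isSmallRadius_X_zpow (n : ℤ) {ε : ℝ} (hε : 0 < ε) : IsSmallRadius (RatFunc.X ^ n) ε := by
  refine ⟨hε, fun p hp hr => ?_⟩
  obtain ⟨j, k, -, h⟩ := X_zpow_mul_algebraMap n
  have hk : (Polynomial.X ^ k : Polynomial ℂ) ≠ 0 := pow_ne_zero _ Polynomial.X_ne_zero
  have hd : (RatFunc.X ^ n : RatFunc ℂ).denom ∣ Polynomial.X ^ k :=
    (RatFunc.denom_dvd hk).2 ⟨_, eq_div_of_mul_eq (RatFunc.algebraMap_ne_zero hk) h⟩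
  have h0 := hr.dvd hd
  rw [Polynomial.IsRoot.def, Polynomial.eval_pow, Polynomial.eval_X] at h0
  exact absurd (eq_zero_of_pow_eq_zero h0) hp

theorem pairing_X_zpow {ω : ℂ → ℂ} (hω : DifferentiableOn ℂ ω {0}ᶜ) (n : ℤ) {r : ℝ} (hr : 0 < r) :
    pairing ω (RatFunc.X ^ n) =
      ∫ θ in (0 : ℝ)..2 * Real.pi, Complex.I * circleMap 0 r θ ^ n * ω (circleMap 0 r θ) := by
  rw [pairing_eq hω (isSmallRadius_X_zpow n hr), circleIntegral]
  refine intervalIntegral.integral_congr fun θ _ => ?_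
  have h : circleMap 0 r θ ≠ 0 := circleMap_ne_center hr.ne'
  simp only [deriv_circleMap, smul_eq_mul, ev_X_zpow n h]
  field_simp

/-- Laurent monomials have no nonzero poles, so the unit circle may be used; there `θ ↦ 2π - θ` is
`z ↦ z⁻¹`. -/
theorem pairing_X_zpow_neg {ω : ℂ → ℂ} (hω : DifferentiableOn ℂ ω {0}ᶜ)
    (hs : ∀ z : ℂ, z ≠ 0 → ω z⁻¹ = ω z) (n : ℤ) :
    pairing ω (RatFunc.X ^ (-n)) = pairing ω (RatFunc.X ^ n) := by
  rw [pairing_X_zpow hω _ one_pos, pairing_X_zpow hω _ one_pos]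
  have h := intervalIntegral.integral_comp_sub_left
    (fun θ => Complex.I * circleMap 0 1 θ ^ n * ω (circleMap 0 1 θ)) (2 * Real.pi)
    (a := 0) (b := 2 * Real.pi)
  rw [sub_self, sub_zero] at h
  rw [← h]
  refine intervalIntegral.integral_congr fun θ _ => ?_
  have h0 : circleMap 0 1 θ ≠ 0 := circleMap_ne_center one_ne_zero
  have h1 : circleMap 0 1 (2 * Real.pi - θ) = (circleMap 0 1 θ)⁻¹ := by
    rw [circleMap_zero_inv, inv_one, ← periodic_circleMap 0 1 (-θ)]
    congr 1
    ring
  simp only [h1, inv_zpow', hs _ h0]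

theorem pairing_symR {ω : ℂ → ℂ} (hω : DifferentiableOn ℂ ω {0}ᶜ)
    (hs : ∀ z : ℂ, z ≠ 0 → ω z⁻¹ = ω z) (k : ℤ) :
    pairing ω (symR k) = 2 * pairing ω (RatFunc.X ^ k) := by
  rw [symR, pairing_add hω, pairing_X_zpow_neg hω hs, two_mul]

/-- A holomorphic function on `ℂ \ {0}` all of whose Laurent coefficients vanish is zero. -/
theorem eq_zero_of_pairing_X_zpow {ω : ℂ → ℂ} (hω : DifferentiableOn ℂ ω {0}ᶜ) (h0 : ω 0 = 0)
    (h : ∀ n : ℤ, pairing ω (RatFunc.X ^ n) = 0) : ω = 0 := by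
  ext z
  rcases eq_or_ne z 0 with rfl | hz
  · exact h0
  have hr : 0 < ‖z‖ := norm_pos_iff.2 hz
  have hpi : Fact (0 < 2 * Real.pi) := ⟨Real.two_pi_pos⟩
  have hne : ∀ θ, circleMap 0 ‖z‖ θ ≠ 0 := fun θ => circleMap_ne_center hr.ne'
  have hcont : Continuous fun θ => ω (circleMap 0 ‖z‖ θ) :=
    hω.continuousOn.comp_continuous (continuous_circleMap 0 ‖z‖) hne
  have hper : Function.Periodic (fun θ => ω (circleMap 0 ‖z‖ θ)) (2 * Real.pi) :=
    fun θ => congrArg ω (periodic_circleMap 0 ‖z‖ θ)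
  let f : C(AddCircle (2 * Real.pi), ℂ) := ⟨hper.lift, hcont.quotient_lift _⟩
  -- On the circle of radius `‖z‖` the `n`-th Fourier coefficient is a scalar multiple of the
  -- pairing with `v^(-n)`.
  have hcoef : ∀ n : ℤ, fourierCoeff f n = 0 := by
    intro n
    rw [fourierCoeff_eq_intervalIntegral f n 0, zero_add]
    have h1 := h (-n)
    rw [pairing_X_zpow hω _ hr] at h1
    have h2 : ∀ θ : ℝ, @fourier (2 * Real.pi) (-n) θ • f θ =
        (Complex.I * (‖z‖ : ℂ) ^ (-n))⁻¹ *
          (Complex.I * circleMap 0 ‖z‖ θ ^ (-n) * ω (circleMap 0 ‖z‖ θ)) := by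
      intro θ
      have h3 : f (θ : AddCircle (2 * Real.pi)) = ω (circleMap 0 ‖z‖ θ) := rfl
      have h4 : circleMap 0 ‖z‖ θ ^ (-n) =
          (‖z‖ : ℂ) ^ (-n) * @fourier (2 * Real.pi) (-n) θ := by
        rw [fourier_coe_apply, circleMap_zero, mul_zpow, ← Complex.exp_int_mul]
        congr 2
        have : (Real.pi : ℂ) ≠ 0 := Complex.ofReal_ne_zero.2 Real.pi_ne_zero
        push_cast
        field_simp
      have h5 : (‖z‖ : ℂ) ^ (-n) ≠ 0 := zpow_ne_zero _ (Complex.ofReal_ne_zero.2 hr.ne')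
      rw [h3, h4, smul_eq_mul]
      field_simp
    simp only [h2, intervalIntegral.integral_const_mul, h1, mul_zero, smul_zero]
  have hsum := has_pointwise_sum_fourier_series_of_summable (f := f)
    (by simpa only [funext hcoef] using summable_zero) (Complex.arg z : AddCircle (2 * Real.pi))
  simp only [hcoef, zero_smul] at hsum
  have h6 : f (Complex.arg z : AddCircle (2 * Real.pi)) = ω z := by
    change ω (circleMap 0 ‖z‖ (Complex.arg z)) = ω z
    rw [circleMap_zero, Complex.norm_mul_exp_arg_mul_I]
  rw [← h6]
  exact hsum.unique hasSum_zero

/-! ### Theta functions -/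

/-- The theta series with coefficients `d n * exp (-c n ^ 2)`, extended by zero to the origin. -/
def thetaSeries (c : ℝ) (d : ℤ → ℂ) (z : ℂ) : ℂ :=
  if z = 0 then 0 else ∑' n : ℤ, d n * (Real.exp (-c * n ^ 2) : ℂ) * z ^ n

theorem summable_exp_sq {c : ℝ} (hc : 0 < c) (L : ℝ) :
    Summable fun n : ℤ => Real.exp (-c * n ^ 2 + L * |n|) := by
  have h := summable_pow_mul_jacobiTheta₂_term_bound (L / (2 * Real.pi)) (div_pos hc Real.pi_pos) 0
  refine h.congr fun n => ?_
  have := Real.pi_ne_zero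
  rw [pow_zero, one_mul]
  congr 1
  push_cast
  field_simp
  ring

theorem exp_int_mul_real (n : ℤ) (x : ℝ) : Real.exp (n * x) = Real.exp x ^ n := by
  have h := Complex.exp_int_mul x n
  exact_mod_cast h

theorem norm_theta_term_le (c : ℝ) {d : ℤ → ℂ} {B : ℝ} (hd : ∀ n, ‖d n‖ ≤ B) {L : ℝ} {z : ℂ}
    (h1 : Real.exp (-L) ≤ ‖z‖) (h2 : ‖z‖ ≤ Real.exp L) (n : ℤ) :
    ‖d n * (Real.exp (-c * n ^ 2) : ℂ) * z ^ n‖ ≤ B * Real.exp (-c * n ^ 2 + L * |n|) := by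
  have hz : 0 < ‖z‖ := (Real.exp_pos _).trans_le h1
  have hzn : ‖z‖ ^ n ≤ Real.exp (L * |n|) := by
    rw [← Real.exp_log hz, ← exp_int_mul_real, mul_comm (n : ℝ)]
    apply Real.exp_le_exp.2
    have h3 : |Real.log ‖z‖| ≤ L := abs_le.2
      ⟨(Real.le_log_iff_exp_le hz).2 h1, (Real.log_le_iff_le_exp hz).2 h2⟩
    calc Real.log ‖z‖ * n ≤ |Real.log ‖z‖ * n| := le_abs_self _
      _ = |Real.log ‖z‖| * |(n : ℝ)| := abs_mul _ _
      _ ≤ L * |(n : ℝ)| := by gcongr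
      _ = L * ((|n| : ℤ) : ℝ) := by push_cast; rfl
  rw [norm_mul, norm_mul, norm_zpow, Complex.norm_real, Real.norm_of_nonneg (Real.exp_pos _).le,
    Real.exp_add, ← mul_assoc]
  have hB := (norm_nonneg _).trans (hd n)
  gcongr
  exact hd n

theorem differentiableOn_thetaSeries {c : ℝ} (hc : 0 < c) {d : ℤ → ℂ} {B : ℝ}
    (hd : ∀ n, ‖d n‖ ≤ B) : DifferentiableOn ℂ (thetaSeries c d) {0}ᶜ := by
  have hcongr : Set.EqOn (thetaSeries c d)
      (fun z => ∑' n : ℤ, d n * (Real.exp (-c * n ^ 2) : ℂ) * z ^ n) {0}ᶜ :=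
    fun z hz => if_neg hz
  refine DifferentiableOn.congr (fun z hz => ?_) hcongr
  have hz0 : 0 < ‖z‖ := norm_pos_iff.2 hz
  set L := |Real.log ‖z‖| + 1
  have hopen : IsOpen {w : ℂ | Real.exp (-L) < ‖w‖ ∧ ‖w‖ < Real.exp L} :=
    (isOpen_lt continuous_const continuous_norm).inter (isOpen_lt continuous_norm continuous_const)
  have hmem : z ∈ {w : ℂ | Real.exp (-L) < ‖w‖ ∧ ‖w‖ < Real.exp L} := by
    constructor
    · rw [← Real.lt_log_iff_exp_lt hz0]
      linarith [neg_abs_le (Real.log ‖z‖)]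
    · rw [← Real.log_lt_iff_lt_exp hz0]
      linarith [le_abs_self (Real.log ‖z‖)]
  refine (DifferentiableOn.differentiableAt ?_ (hopen.mem_nhds hmem)).differentiableWithinAt
  refine Complex.differentiableOn_tsum_of_summable_norm
    ((summable_exp_sq hc L).mul_left B) (fun n w hw => ?_) hopen fun n w hw =>
      norm_theta_term_le c hd hw.1.le hw.2.le n
  have hw0 : w ≠ 0 := norm_pos_iff.1 ((Real.exp_pos _).trans hw.1)
  exact ((differentiableAt_zpow.2 (Or.inl hw0)).const_mul _).differentiableWithinAt

/-- Completing the square, `exp (-c (n + 2μ)²) = q^μ q^n exp (-c n²)` when `exp (-4cμ) = q`. So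
reindexing by `2μ` gives the quasi-periodicity, and evenness of `d` gives the symmetry. -/
theorem thetaSeries_mem {c : ℝ} (hc : 0 < c) {μ : ℕ}
    (hcμ : Real.exp (-c * (4 * μ)) = q) {d : ℤ → ℂ} {B : ℝ} (hd : ∀ n, ‖d n‖ ≤ B)
    (hneg : ∀ n, d (-n) = d n) (hper : ∀ n, d (n + 2 * μ) = d n) :
    thetaSeries c d ∈ quasiPeriodic q (2 * μ) := by
  rw [mem_quasiPeriodic_iff]
  refine ⟨differentiableOn_thetaSeries hc hd, if_pos rfl, fun z hz => ?_, fun z hz => ?_⟩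
  · rw [thetaSeries, if_neg (inv_ne_zero hz), thetaSeries, if_neg hz, ← (Equiv.neg ℤ).tsum_eq]
    refine tsum_congr fun n => ?_
    rw [Equiv.neg_apply, hneg, Int.cast_neg, neg_sq, inv_zpow, zpow_neg, inv_inv]
  · have hq := qC_ne_zero q
    rw [thetaSeries, if_neg (mul_ne_zero hq hz), thetaSeries, if_neg hz, ← tsum_mul_left,
      ← (Equiv.addRight (2 * μ : ℤ)).tsum_eq
        fun n : ℤ => d n * (Real.exp (-c * n ^ 2) : ℂ) * z ^ n]
    refine tsum_congr fun n => ?_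
    have h : (Real.exp (-c * ((n + 2 * μ : ℤ) : ℝ) ^ 2) : ℂ) =
        qC q ^ (μ : ℤ) * qC q ^ n * (Real.exp (-c * n ^ 2) : ℂ) := by
      rw [qC, ← hcμ, ← zpow_add₀ (Complex.ofReal_ne_zero.2 (Real.exp_pos _).ne'),
        ← Complex.ofReal_zpow, ← Complex.ofReal_mul, ← exp_int_mul_real, ← Real.exp_add]
      congr 2
      push_cast
      ring
    rw [Equiv.coe_addRight, hper, h, zpow_add₀ hz, mul_zpow]
    ring

theorem integral_circleMap_zpow (n : ℤ) :
    ∫ θ in (0 : ℝ)..2 * Real.pi, Complex.I * circleMap 0 1 θ ^ n =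
      if n = 0 then 2 * Real.pi * Complex.I else 0 := by
  have h : ∫ θ in (0 : ℝ)..2 * Real.pi, Complex.I * circleMap 0 1 θ ^ n =
      ∮ z in C(0, 1), (z - 0) ^ (n - 1) := by
    rw [circleIntegral]
    refine intervalIntegral.integral_congr fun θ _ => ?_
    have h : circleMap 0 1 θ ≠ 0 := circleMap_ne_center one_ne_zero
    simp only [deriv_circleMap, smul_eq_mul, sub_zero, zpow_sub_one₀ h]
    field_simp
  rw [h]
  split_ifs with hn
  · subst hn
    rw [← circleIntegral.integral_sub_center_inv 0 one_ne_zero]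
    simp
  · exact circleIntegral.integral_sub_zpow_of_ne (by omega) _ _ _

theorem pairing_thetaSeries {c : ℝ} (hc : 0 < c) {d : ℤ → ℂ} {B : ℝ} (hd : ∀ n, ‖d n‖ ≤ B)
    (k : ℤ) : pairing (thetaSeries c d) (RatFunc.X ^ k) =
      2 * Real.pi * Complex.I * (d (-k) * (Real.exp (-c * k ^ 2) : ℂ)) := by
  have hne : ∀ θ, circleMap 0 1 θ ≠ 0 := fun θ => circleMap_ne_center one_ne_zero
  rw [pairing_X_zpow (differentiableOn_thetaSeries hc hd) k one_pos]
  set a : ℤ → ℂ := fun n => d n * (Real.exp (-c * n ^ 2) : ℂ)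
  have hle : ∀ (n : ℤ) (θ : ℝ), ‖a n * circleMap 0 1 θ ^ n‖ ≤
      B * Real.exp (-c * n ^ 2 + 0 * |n|) := fun n θ =>
    norm_theta_term_le c hd (by simp) (by simp) n
  have hsum : Summable fun n : ℤ => B * Real.exp (-c * n ^ 2 + 0 * |n|) :=
    (summable_exp_sq hc 0).mul_left B
  have hcontz : ∀ n : ℤ, Continuous fun θ => circleMap 0 1 θ ^ n := fun n =>
    (continuous_circleMap 0 1).zpow₀ n fun θ => Or.inl (hne θ)
  have h1 := intervalIntegral.hasSum_integral_of_dominated_convergence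
    (μ := MeasureTheory.volume) (a := 0) (b := 2 * Real.pi)
    (F := fun (n : ℤ) θ => a n * (Complex.I * circleMap 0 1 θ ^ (k + n)))
    (f := fun θ => Complex.I * circleMap 0 1 θ ^ k * thetaSeries c d (circleMap 0 1 θ))
    (fun n _ => B * Real.exp (-c * n ^ 2 + 0 * |n|))
    (fun n => ((hcontz (k + n)).const_mul _ |>.const_mul _).aestronglyMeasurable)
    (fun n => Filter.Eventually.of_forall fun θ _ => ?_)
    (Filter.Eventually.of_forall fun _ _ => hsum)
    intervalIntegrable_const
    (Filter.Eventually.of_forall fun θ _ => ?_)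
  · refine h1.unique ?_
    convert! hasSum_ite_eq (-k) (2 * Real.pi * Complex.I * a (-k)) using 2 with n
    · rw [intervalIntegral.integral_const_mul, integral_circleMap_zpow]
      by_cases hn : n = -k
      · rw [if_pos (by omega), if_pos hn, hn, mul_comm]
      · rw [if_neg (by omega), if_neg hn, mul_zero]
    · simp [a]
  · refine le_trans (le_of_eq ?_) (hle n θ)
    simp
  · have h3 : Summable fun n : ℤ => a n * circleMap 0 1 θ ^ n :=
      Summable.of_norm_bounded hsum fun n => hle n θ
    rw [thetaSeries, if_neg (hne θ)]
    convert! h3.hasSum.mul_left (Complex.I * circleMap 0 1 θ ^ k) using 2 with n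
    rw [zpow_add₀ (hne θ)]
    ring

/-! ### Even parts of twisted traces -/

theorem exists_quasiPeriodic (μ : ℕ) (v : ℕ → ℂ) :
    ∃ ω ∈ quasiPeriodic q (2 * μ), ∀ k ≤ μ, pairing ω (symR k) = v k := by
  have hpi : (Real.pi : ℂ) ≠ 0 := Complex.ofReal_ne_zero.2 Real.pi_ne_zero
  have hI := Complex.I_ne_zero
  rcases Nat.eq_zero_or_pos μ with rfl | hμ
  -- For `μ = 0` no Gaussian rate `c` exists, and constants serve instead. The factor 4 is twice the
  -- usual 2, because `s_0 = 2`.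
  · set C := v 0 / (4 * Real.pi * Complex.I) with hC
    have hd : DifferentiableOn ℂ (fun z : ℂ => if z = 0 then 0 else C) {0}ᶜ :=
      (differentiableOn_const C).congr fun z hz => if_neg hz
    have hs : ∀ z : ℂ, z ≠ 0 → (fun z : ℂ => if z = 0 then 0 else C) z⁻¹ =
        (fun z : ℂ => if z = 0 then 0 else C) z := fun z _ => by simp
    refine ⟨fun z => if z = 0 then 0 else C,
      (mem_quasiPeriodic_iff q 0 _).2 ⟨hd, if_pos rfl, hs, fun z hz => ?_⟩, fun k hk => ?_⟩
    · simp [hz, qC_ne_zero q]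
    · obtain rfl : k = 0 := by omega
      rw [pairing_symR hd hs, pairing_X_zpow hd _ one_pos, hC]
      have hne : ∀ θ, circleMap 0 1 θ ≠ 0 := fun θ => circleMap_ne_center one_ne_zero
      simp only [hne, if_false, Nat.cast_zero, zpow_zero, intervalIntegral.integral_const,
        sub_zero, Complex.real_smul]
      push_cast
      field_simp
      ring
  · have hlog : Real.log q < 0 := Real.log_neg q.2.1 q.2.2
    have hμ' : (0 : ℝ) < μ := Nat.cast_pos.2 hμ
    set c := -Real.log q / (4 * μ) with hc
    have hc0 : 0 < c := div_pos (neg_pos.2 hlog) (by positivity)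
    have hcμ : Real.exp (-c * (4 * μ)) = q := by
      rw [hc, show -(-Real.log q / (4 * μ)) * (4 * μ) = Real.log q by field_simp,
        Real.exp_log q.2.1]
    have : NeZero (2 * μ) := ⟨by omega⟩
    set w : ℕ → ℂ := fun k => v k / (4 * Real.pi * Complex.I * (Real.exp (-c * k ^ 2) : ℂ))
    -- An even `2μ`-periodic sequence is freely prescribed on `0, ..., μ`: evaluate at the distance
    -- from `n` to the nearest multiple of `2μ`.
    set d : ℤ → ℂ := fun n => w (n : ZMod (2 * μ)).valMinAbs.natAbs with hd
    have hdB : ∀ n, ‖d n‖ ≤ ∑ k ∈ Finset.range (μ + 1), ‖w k‖ := fun n => by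
      have h := ZMod.natAbs_valMinAbs_le (n : ZMod (2 * μ))
      exact Finset.single_le_sum (f := fun k => ‖w k‖) (fun _ _ => norm_nonneg _)
        (Finset.mem_range.2 (by omega))
    have hneg : ∀ n, d (-n) = d n := fun n => by
      simp only [hd, Int.cast_neg, ZMod.natAbs_valMinAbs_neg]
    have hper : ∀ n, d (n + 2 * μ) = d n := fun n => by
      have h : ((n + 2 * μ : ℤ) : ZMod (2 * μ)) = n := by
        have h2 := ZMod.natCast_self (2 * μ)
        push_cast at h2 ⊢
        rw [h2, add_zero]
      simp only [hd, h]
    have hmem := thetaSeries_mem hc0 hcμ hdB hneg hper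
    refine ⟨_, hmem, fun k hk => ?_⟩
    have hdk : d k = w k := by
      simp only [hd, Int.cast_natCast]
      rw [ZMod.valMinAbs_natCast_of_le_half (by omega), Int.natAbs_natCast]
    have hexp : (Real.exp (-c * k ^ 2) : ℂ) ≠ 0 :=
      Complex.ofReal_ne_zero.2 (Real.exp_pos _).ne'
    rw [pairing_symR hmem.1 hmem.2.2.1, pairing_thetaSeries hc0 hdB, hneg, hdk]
    simp only [w, Int.cast_natCast]
    field_simp
    ring

theorem isEvenElt_symA (k : ℤ) : IsEvenElt (symA q k) := fun i hi => by
  rw [wCoeff, coe_symA, coeff_mono, if_neg]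
  rintro rfl
  exact absurd hi (by decide)

/-- The algebraic uniqueness for traces, applied to the trace of `ω`, makes the pairing with every
`s_n` vanish, and by symmetry the pairing with every `v^n`. -/
theorem eq_zero_of_pairing_symR {μ : ℕ} {ω : ℂ → ℂ} (hω : ω ∈ quasiPeriodic q (2 * μ))
    (h : ∀ k : ℕ, k ≤ μ → pairing ω (symR k) = 0) : ω = 0 := by
  refine eq_zero_of_pairing_X_zpow hω.1 hω.2.1 fun n => ?_
  have h1 := trace_eq_zero_of_isEvenElt (quasiTrace_isTwistedTrace hω)
    (fun k hk => (quasiTrace_symA hω k).trans (h k hk)) (isEvenElt_symA n)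
  rw [quasiTrace_symA, pairing_symR hω.1 hω.2.2.1] at h1
  simpa using h1

/-- Choose `ω` with the same values as `T` on `s_0, ..., s_μ`; the difference of the two traces then
vanishes on even elements. -/
theorem IsTwistedTrace.exists_quasiTrace {μ : ℕ} {T : algA q →ₗ[ℂ] ℂ}
    (hT : IsTwistedTrace (twistEquiv q μ) T) :
    ∃ (ω : ℂ → ℂ) (hω : ω ∈ quasiPeriodic q (2 * μ)),
      ∀ a, IsEvenElt a → T a = quasiTrace hω a := by
  obtain ⟨ω, hω, h⟩ := exists_quasiPeriodic (q := q) μ fun k => T (symA q k)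
  refine ⟨ω, hω, fun a ha => ?_⟩
  have hsub : IsTwistedTrace (twistEquiv q μ) (T - quasiTrace hω) := fun a b => by
    rw [LinearMap.sub_apply, LinearMap.sub_apply, hT a b, quasiTrace_isTwistedTrace hω a b]
  have h0 := trace_eq_zero_of_isEvenElt hsub
    (fun k hk => by rw [LinearMap.sub_apply, quasiTrace_symA, h k hk, sub_self]) ha
  rwa [LinearMap.sub_apply, sub_eq_zero] at h0

/-- The functional on `A₀` attached to a quasi-periodic function. -/
def quasiEvenPart {μ : ℕ} {ω : ℂ → ℂ} (hω : ω ∈ quasiPeriodic q (2 * μ)) : A0 q →ₗ[ℂ] ℂ :=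
  (pairingHom hω.1).domRestrict (A0 q)

theorem quasiEvenPart_apply {μ : ℕ} {ω : ℂ → ℂ} (hω : ω ∈ quasiPeriodic q (2 * μ)) (F : A0 q) :
    quasiEvenPart hω F = pairing ω F := rfl

theorem isEvenPart_quasiEvenPart {μ : ℕ} {ω : ℂ → ℂ} (hω : ω ∈ quasiPeriodic q (2 * μ)) :
    IsEvenPart (quasiTrace hω) (quasiEvenPart hω) := fun a _ F hF => by
  rw [quasiTrace_apply, ← hF, quasiEvenPart_apply]

/-- Every element of `A₀` is the constant term of an even element, so no value of `S` is left free.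
-/
theorem IsEvenPart.unique {T T' : algA q →ₗ[ℂ] ℂ} {S S' : A0 q →ₗ[ℂ] ℂ}
    (h : ∀ a, IsEvenElt a → T a = T' a) (hS : IsEvenPart T S) (hS' : IsEvenPart T' S') :
    S = S' := by
  ext F
  obtain ⟨a, ha, haF⟩ := exists_isEvenElt q F.2
  rw [← hS a ha F haF.symm, ← hS' a ha F haF.symm, h a ha]

theorem IsTwistedTrace.existsUnique_evenPart {μ : ℕ} {T : algA q →ₗ[ℂ] ℂ}
    (hT : IsTwistedTrace (twistEquiv q μ) T) : ∃! S : A0 q →ₗ[ℂ] ℂ, IsEvenPart T S := by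
  obtain ⟨ω, hω, h⟩ := hT.exists_quasiTrace
  have hS : IsEvenPart T (quasiEvenPart hω) := fun a ha F hF => by
    rw [h a ha, isEvenPart_quasiEvenPart hω a ha F hF]
  exact ⟨_, hS, fun S hS' => hS'.unique (fun _ _ => rfl) hS⟩

variable (q) in
/-- The moments of a quasi-periodic function. -/
def symMoments (μ : ℕ) : quasiPeriodic q (2 * μ) →ₗ[ℂ] (Fin (μ + 1) → ℂ) where
  toFun ω k := pairing ω (symR (k : ℕ))
  map_add' ω ω' := funext fun _ => pairing_add_left ω.2.1 ω'.2.1 _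
  map_smul' c ω := funext fun _ => pairing_smul_left ω.2.1 c _

theorem symMoments_bijective (μ : ℕ) : Function.Bijective (symMoments q μ) := by
  constructor
  · rw [injective_iff_map_eq_zero]
    intro ω h
    refine Subtype.ext (eq_zero_of_pairing_symR ω.2 fun k hk => ?_)
    exact congrFun h ⟨k, by omega⟩
  · intro v
    obtain ⟨ω, hω, h⟩ := exists_quasiPeriodic (q := q) μ
      fun k => if hk : k < μ + 1 then v ⟨k, hk⟩ else 0
    refine ⟨⟨ω, hω⟩, funext fun k => (h k (by omega)).trans ?_⟩
    rw [dif_pos k.2]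

theorem finrank_quasiPeriodic (μ : ℕ) : Module.finrank ℂ (quasiPeriodic q (2 * μ)) = μ + 1 := by
  rw [(LinearEquiv.ofBijective _ (symMoments_bijective μ)).finrank_eq, Module.finrank_fin_fun]

variable (q) in
/-- The even part of the trace attached to a quasi-periodic function. -/
def quasiToEven (μ : ℕ) : quasiPeriodic q (2 * μ) →ₗ[ℂ] evenTraces (twistEquiv q μ) where
  toFun ω := ⟨quasiEvenPart ω.2, quasiTrace ω.2, quasiTrace_isTwistedTrace ω.2,
    isEvenPart_quasiEvenPart ω.2⟩
  map_add' ω ω' := Subtype.ext <| LinearMap.ext fun _ => pairing_add_left ω.2.1 ω'.2.1 _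
  map_smul' c ω := Subtype.ext <| LinearMap.ext fun _ => pairing_smul_left ω.2.1 c _

theorem quasiToEven_bijective (μ : ℕ) : Function.Bijective (quasiToEven q μ) := by
  constructor
  · rw [injective_iff_map_eq_zero]
    intro ω h
    refine Subtype.ext (eq_zero_of_pairing_symR ω.2 fun k _ => ?_)
    have h1 := congrArg Subtype.val h
    exact LinearMap.congr_fun h1 ⟨symR k, symSpan_le_A0 q (symR_mem k)⟩
  · rintro ⟨S, T, hT, hS⟩
    obtain ⟨ω, hω, h⟩ := hT.exists_quasiTrace
    exact ⟨⟨ω, hω⟩, Subtype.ext ((isEvenPart_quasiEvenPart hω).unique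
      (fun a ha => (h a ha).symm) hS)⟩

end PureSL2

end

/-! ### Assembly of the main theorem, with `m = 2μ`. -/

theorem mainTheorem8 (q : Set.Ioo (0 : ℝ) 1) (m : ℕ) (hm : Even m) :
    (∃! g : PureSL2.algA q ≃ₐ[ℂ] PureSL2.algA q,
      ∀ a : ℤ, g (PureSL2.H q a) = PureSL2.H q (a + m)) ∧
    (∀ a : PureSL2.algA q, PureSL2.wCoeff 0 a ∈ PureSL2.A0 q) ∧
    (∀ F ∈ PureSL2.A0 q, ∃ a : PureSL2.algA q,
      PureSL2.IsEvenElt a ∧ PureSL2.wCoeff 0 a = F) ∧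
    ∀ g : PureSL2.algA q ≃ₐ[ℂ] PureSL2.algA q,
      (∀ a : ℤ, g (PureSL2.H q a) = PureSL2.H q (a + m)) →
      (∀ T : PureSL2.algA q →ₗ[ℂ] ℂ, PureSL2.IsTwistedTrace g T →
        ∃! S : PureSL2.A0 q →ₗ[ℂ] ℂ, PureSL2.IsEvenPart T S) ∧
      (∃ Φ : PureSL2.quasiPeriodic q m ≃ₗ[ℂ] PureSL2.evenTraces g,
        ∀ (ω : PureSL2.quasiPeriodic q m) (F : PureSL2.A0 q) (ε : ℝ),
          PureSL2.IsSmallRadius (F : RatFunc ℂ) ε →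
          (Φ ω : PureSL2.A0 q →ₗ[ℂ] ℂ) F =
            ∮ z in C(0, ε), RatFunc.eval (RingHom.id ℂ) z (F : RatFunc ℂ) *
              (ω : ℂ → ℂ) z / z) ∧
      (∀ ω ∈ PureSL2.quasiPeriodic q m,
        ∃ T : PureSL2.algA q →ₗ[ℂ] ℂ, PureSL2.IsTwistedTrace g T ∧
          ∀ (a : PureSL2.algA q) (ε : ℝ), PureSL2.IsSmallRadius (PureSL2.wCoeff 0 a) ε →
            T a = ∮ z in C(0, ε),
              RatFunc.eval (RingHom.id ℂ) z (PureSL2.wCoeff 0 a) * ω z / z) ∧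
      Module.finrank ℂ (PureSL2.quasiPeriodic q m) = 1 + m / 2 ∧
      Module.finrank ℂ (PureSL2.evenTraces g) = 1 + m / 2 := by
  obtain ⟨μ, rfl⟩ := hm.exists_two_nsmul
  rw [smul_eq_mul]
  have hdim : 1 + 2 * μ / 2 = μ + 1 := by omega
  have hg := PureSL2.map_H_iff q (m := 2 * μ) (μ := μ) rfl
  refine ⟨⟨PureSL2.twistEquiv q μ, (hg _).2 rfl, fun g h => (hg g).1 h⟩,
    PureSL2.wCoeff_zero_mem_A0 q, fun F hF => PureSL2.exists_isEvenElt q hF, fun g h => ?_⟩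
  obtain rfl := (hg g).1 h
  set Φ := LinearEquiv.ofBijective _ (PureSL2.quasiToEven_bijective (q := q) μ)
  refine ⟨fun T hT => hT.existsUnique_evenPart, ⟨Φ, fun ω F ε hε => ?_⟩, fun ω hω =>
    ⟨PureSL2.quasiTrace hω, PureSL2.quasiTrace_isTwistedTrace hω, fun a ε hε => ?_⟩, ?_, ?_⟩
  · exact PureSL2.pairing_eq ω.2.1 hε
  · exact PureSL2.pairing_eq hω.1 hε
  · rw [PureSL2.finrank_quasiPeriodic, hdim]
  · rw [← Φ.finrank_eq, PureSL2.finrank_quasiPeriodic, hdim]
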